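/- **Setting.** Let $\varepsilon_0$ be the set of terms generated as follows, simultaneously with the lexicographic order $\prec$: if $\alpha_0,\ldots,\alpha_{n-1}\in\varepsilon_0$ ($n\ge 0$) satisfy $\alpha_i\preceq\alpha_{i-1}$ for $0<i<n$, then $\langle\alpha_0,\ldots,\alpha_{n-1}\rangle\in\varepsilon_0$. Here $\langle\alpha_0,\ldots,\alpha_{m-1}\rangle\prec\langle\beta_0,\ldots,\beta_{n-1}\rangle$ holds if and only if either $m<n$ and $\alpha_i=\beta_i$ for all $i<m$, or there is $j<\min(m,n)$ with $\alpha_j\prec\beta_j$ and $\alpha_i=\beta_i$ for all $i<j$; and $\alpha\preceq\beta$ means $\alpha\prec\beta$ or $\alpha=\beta$. Let $\mathcal B$ be the set of binary trees generated by $\circ\in\mathcal B$ and $s,t\in\mathcal B\Rightarrow\circ(s,t)\in\mathcal B$. The relation $\leq_{\mathcal B}$ is given recursively by: $\circ\leq_{\mathcal B}t$ for all $t$; $s\leq_{\mathcal B}\circ$ only for $s=\circ$; and $\circ(s_0,s_1)\leq_{\mathcal B}\circ(t_0,t_1)$ if and only if ($s_0\leq_{\mathcal B}t_0$ and $s_1\leq_{\mathcal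 B}t_1$) or $\circ(s_0,s_1)\leq_{\mathcal B}t_0$ or $\circ(s_0,s_1)\leq_{\mathcal B}t_1$. $\mathsf{ACA}_0$ is the theory in the language of second order arithmetic (number variables, set variables, $0,S,+,\times,=,\leq,\in$) with the equality axioms (including $x=y\land x\in X\to y\in X$), the axioms of Robinson arithmetic, the comprehension axioms $\exists X\forall x(x\in X\leftrightarrow\varphi(x))$ for all formulas $\varphi$ without set quantifiers (with number and set parameters, $X$ not free in $\varphi$), and the induction axiom $\forall X\,[\,0\in X\land\forall x(x\in X\to Sx\in X)\to\forall x\,(x\in X)\,]$. Provability means derivability in a (Tait style, two-sorted) sequent calculus for classical predicate logic from these axioms. With $\langle x,y\rangle=\frac{(x+y)(x+y+1)}2+y$ denoting Cantor pairing, finite objects are coded by natural numbers: $\langle\rangle$ and $\circ$ have code $0$; a term $\langle\alpha_0,\ldots,\alpha_{n-1}\rangle$ with $n>0$ has code $\langle a,b\rangle+1$ for the codes $a$ of $\alpha_0$ and $b$ of $\langle\alpha_1,\ldots,\alpha_{n-1}\rangle$; and $\circ(s,t)$ has code $\langle a,b\rangle+1$ for the codes $a$ of $s$ and $b$ of $t$.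 The sets $\varepsilon_0,\mathcal B$ and the relations $\prec,\leq_{\mathcal B}$ on codes are expressed by the arithmetical formulas that formalize the given definitions by course-of-values recursion. A function $f:\varepsilon_0\to\mathcal B$ is represented by the set $\{\langle\alpha,f(\alpha)\rangle\mid\alpha\in\varepsilon_0\}\subseteq\mathbb N$. **Proposition 6.4.** The theory $\mathsf{ACA}_0$ proves the following sentence: there is (a set that represents) a function $f:\varepsilon_0\to\mathcal B$ such that (1) $f(\langle\rangle)=\circ$, and $f(\langle\alpha_0,\ldots,\alpha_{n-1}\rangle)=\circ\bigl(f(\alpha_0),f(\langle\alpha_1,\ldots,\alpha_{n-1}\rangle)\bigr)$ for all $\langle\alpha_0,\ldots,\alpha_{n-1}\rangle\in\varepsilon_0$ with $n>0$; (2) $f$ reflects the order, i.e., for all $\alpha,\beta\in\varepsilon_0$, if $f(\alpha)\leq_{\mathcal B}f(\beta)$ then $\alpha\preceq\beta$. -/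

import Mathlib

namespace SecondOrderArithmetic

/-! ### The language of second order arithmetic

Number variables and set variables are de Bruijn indices, counted separately: a number quantifier
binds number variable `0` of its body (and shifts the other number variables by one), a set
quantifier does the same for set variables. Indices that are not bound are free variables. -/

/-- Terms over `0`, `S`, `+`, `*`. -/
inductive Tm : Type
  | var (i : ℕ) : Tm
  | zero : Tm
  | succ (t : Tm) : Tm
  | add (s t : Tm) : Tm
  | mul (s t : Tm) : Tm

/-- Prime formulas `s = t`, `s ≤ t` and `t ∈ X`. -/
inductive Atom : Type
  | eq (s t : Tm) : Atom
  | le (s t : Tm) : Atom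
  | mem (t : Tm) (X : ℕ) : Atom

/-- Formulas of second order arithmetic in negation normal form. -/
inductive Fml : Type
  | pos (a : Atom) : Fml
  | neg (a : Atom) : Fml
  | and (φ ψ : Fml) : Fml
  | or (φ ψ : Fml) : Fml
  | all (φ : Fml) : Fml
  | ex (φ : Fml) : Fml
  | allSet (φ : Fml) : Fml
  | exSet (φ : Fml) : Fml

namespace Tm

/-- Simultaneous substitution of terms for the variables. -/
def subst (σ : ℕ → Tm) : Tm → Tm
  | var i => σ i
  | zero => zero
  | succ t => succ (t.subst σ)
  | add s t => add (s.subst σ) (t.subst σ)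
  | mul s t => mul (s.subst σ) (t.subst σ)

/-- Shift all variables by `k`: to be used when a term is moved below `k` number quantifiers. -/
def lift (k : ℕ) (t : Tm) : Tm := t.subst fun i => var (i + k)

/-- The substitution to be used below a number quantifier. -/
def upSubst (σ : ℕ → Tm) : ℕ → Tm
  | 0 => var 0
  | i + 1 => (σ i).lift 1

end Tm

/-- The renaming to be used below a set quantifier. -/
def upRen (ρ : ℕ → ℕ) : ℕ → ℕ
  | 0 => 0
  | i + 1 => ρ i + 1

/-- Simultaneous substitution in a prime formula (of terms for number variables and of set
variables for set variables). -/
def Atom.subst (σ : ℕ → Tm) (ρ : ℕ → ℕ) : Atom → Atom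
  | .eq s t => .eq (s.subst σ) (t.subst σ)
  | .le s t => .le (s.subst σ) (t.subst σ)
  | .mem t X => .mem (t.subst σ) (ρ X)

namespace Fml

/-- Capture-avoiding simultaneous substitution. -/
def subst : (ℕ → Tm) → (ℕ → ℕ) → Fml → Fml
  | σ, ρ, pos a => pos (a.subst σ ρ)
  | σ, ρ, neg a => neg (a.subst σ ρ)
  | σ, ρ, and φ ψ => and (subst σ ρ φ) (subst σ ρ ψ)
  | σ, ρ, or φ ψ => or (subst σ ρ φ) (subst σ ρ ψ)
  | σ, ρ, all φ => all (subst (Tm.upSubst σ) ρ φ)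
  | σ, ρ, ex φ => ex (subst (Tm.upSubst σ) ρ φ)
  | σ, ρ, allSet φ => allSet (subst σ (upRen ρ) φ)
  | σ, ρ, exSet φ => exSet (subst σ (upRen ρ) φ)

/-- Shift the number variables, so that number variable `0` becomes fresh. -/
def shift (φ : Fml) : Fml := φ.subst (fun i => .var (i + 1)) id

/-- Shift the set variables, so that set variable `0` becomes fresh. -/
def shiftSet (φ : Fml) : Fml := φ.subst .var (· + 1)

/-- Instantiate number variable `0` by the term `t` (the other variables move down). -/
def inst (φ : Fml) (t : Tm) : Fml :=
  φ.subst (fun i => Nat.casesOn i t fun j => .var j) id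

/-- Instantiate set variable `0` by the set variable `X` (the other set variables move down). -/
def instSet (φ : Fml) (X : ℕ) : Fml :=
  φ.subst .var fun i => Nat.casesOn i X fun j => j

/-- Negation, by de Morgan's rules. -/
def not : Fml → Fml
  | pos a => neg a
  | neg a => pos a
  | and φ ψ => or φ.not ψ.not
  | or φ ψ => and φ.not ψ.not
  | all φ => ex φ.not
  | ex φ => all φ.not
  | allSet φ => exSet φ.not
  | exSet φ => allSet φ.not

def imp (φ ψ : Fml) : Fml := or φ.not ψ

def iff (φ ψ : Fml) : Fml := and (imp φ ψ) (imp ψ φ)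

/-- A formula is arithmetical if it contains no set quantifiers. -/
def IsArithmetical : Fml → Prop
  | pos _ => True
  | neg _ => True
  | and φ ψ => φ.IsArithmetical ∧ ψ.IsArithmetical
  | or φ ψ => φ.IsArithmetical ∧ ψ.IsArithmetical
  | all φ => φ.IsArithmetical
  | ex φ => φ.IsArithmetical
  | allSet _ => False
  | exSet _ => False

def eq (s t : Tm) : Fml := pos (.eq s t)

def le (s t : Tm) : Fml := pos (.le s t)

def mem (t : Tm) (X : ℕ) : Fml := pos (.mem t X)

/-! Quantifier blocks in which the bound variables get names: `all₂ fun x y => φ` is `∀ x, ∀ y, φ`.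
Terms that come from outside such a block of `k` quantifiers appear in it as `t.lift k`. -/

def all₁ (f : Tm → Fml) : Fml := all (f (.var 0))

def all₂ (f : Tm → Tm → Fml) : Fml := all (all (f (.var 1) (.var 0)))

def all₃ (f : Tm → Tm → Tm → Fml) : Fml := all (all (all (f (.var 2) (.var 1) (.var 0))))

def all₄ (f : Tm → Tm → Tm → Tm → Fml) : Fml :=
  all (all (all (all (f (.var 3) (.var 2) (.var 1) (.var 0)))))

def ex₁ (f : Tm → Fml) : Fml := ex (f (.var 0))

def ex₂ (f : Tm → Tm → Fml) : Fml := ex (ex (f (.var 1) (.var 0)))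

def ex₄ (f : Tm → Tm → Tm → Tm → Fml) : Fml :=
  ex (ex (ex (ex (f (.var 3) (.var 2) (.var 1) (.var 0)))))

end Fml

open Fml

/-! ### Derivations -/

/-- Tait style sequent calculus for two-sorted classical predicate logic, with the formulas in `T`
as additional axioms (free variables in these are understood universally). A sequent `Γ` is a finite
list of formulas, of which only the set of entries matters, and stands for their disjunction. The
lower sequent of each rule may contain arbitrary side formulas. In the rules for universal
quantifiers, the eigenvariable is the variable `0`, which is made fresh for `Γ` by the shift. -/
inductive Derivable (T : Set Fml) : List Fml → Prop
  | ax {Γ : List Fml} {φ : Fml} (hT : φ ∈ T) (h : φ ∈ Γ) : Derivable T Γ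
  | lit {Γ : List Fml} {a : Atom} (hp : pos a ∈ Γ) (hn : neg a ∈ Γ) : Derivable T Γ
  | and {Γ : List Fml} {φ ψ : Fml} (h : and φ ψ ∈ Γ)
      (d₀ : Derivable T (φ :: Γ)) (d₁ : Derivable T (ψ :: Γ)) : Derivable T Γ
  | orLeft {Γ : List Fml} {φ ψ : Fml} (h : or φ ψ ∈ Γ)
      (d : Derivable T (φ :: Γ)) : Derivable T Γ
  | orRight {Γ : List Fml} {φ ψ : Fml} (h : or φ ψ ∈ Γ)
      (d : Derivable T (ψ :: Γ)) : Derivable T Γ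
  | all {Γ : List Fml} {φ : Fml} (h : all φ ∈ Γ)
      (d : Derivable T (φ :: Γ.map shift)) : Derivable T Γ
  | ex {Γ : List Fml} {φ : Fml} (t : Tm) (h : ex φ ∈ Γ)
      (d : Derivable T (φ.inst t :: Γ)) : Derivable T Γ
  | allSet {Γ : List Fml} {φ : Fml} (h : allSet φ ∈ Γ)
      (d : Derivable T (φ :: Γ.map shiftSet)) : Derivable T Γ
  | exSet {Γ : List Fml} {φ : Fml} (X : ℕ) (h : exSet φ ∈ Γ)
      (d : Derivable T (φ.instSet X :: Γ)) : Derivable T Γ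
  | cut {Γ : List Fml} (φ : Fml)
      (d₀ : Derivable T (φ :: Γ)) (d₁ : Derivable T (φ.not :: Γ)) : Derivable T Γ

/-- The theory `T` proves the formula `φ`. -/
def Proves (T : Set Fml) (φ : Fml) : Prop := Derivable T [φ]

/-! ### The theory `ACA₀` -/

/-- The equality axioms, including `x = y ∧ x ∈ X → y ∈ X`. -/
inductive EqualityAxiom : Fml → Prop
  | refl : EqualityAxiom (all₁ fun x => eq x x)
  | symm : EqualityAxiom (all₂ fun x y => imp (eq x y) (eq y x))
  | trans : EqualityAxiom (all₃ fun x y z => imp (and (eq x y) (eq y z)) (eq x z))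
  | succ : EqualityAxiom (all₂ fun x y => imp (eq x y) (eq (.succ x) (.succ y)))
  | add : EqualityAxiom (all₄ fun x x' y y' =>
      imp (and (eq x x') (eq y y')) (eq (.add x y) (.add x' y')))
  | mul : EqualityAxiom (all₄ fun x x' y y' =>
      imp (and (eq x x') (eq y y')) (eq (.mul x y) (.mul x' y')))
  | le : EqualityAxiom (all₄ fun x x' y y' =>
      imp (and (eq x x') (eq y y')) (imp (le x y) (le x' y')))
  | mem : EqualityAxiom (allSet (all₂ fun x y => imp (and (eq x y) (mem x 0)) (mem y 0)))

/-- The axioms (Q1)-(Q8) of Robinson arithmetic, following Hájek and Pudlák. -/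
inductive RobinsonAxiom : Fml → Prop
  | q1 : RobinsonAxiom (all₁ fun x => not (eq (.succ x) .zero))
  | q2 : RobinsonAxiom (all₂ fun x y => imp (eq (.succ x) (.succ y)) (eq x y))
  | q3 : RobinsonAxiom (all₁ fun x =>
      imp (not (eq x .zero)) (ex₁ fun y => eq (x.lift 1) (.succ y)))
  | q4 : RobinsonAxiom (all₁ fun x => eq (.add x .zero) x)
  | q5 : RobinsonAxiom (all₂ fun x y => eq (.add x (.succ y)) (.succ (.add x y)))
  | q6 : RobinsonAxiom (all₁ fun x => eq (.mul x .zero) .zero)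
  | q7 : RobinsonAxiom (all₂ fun x y => eq (.mul x (.succ y)) (.add (.mul x y) x))
  | q8 : RobinsonAxiom (all₂ fun x y =>
      iff (le x y) (ex₁ fun z => eq (.add z (x.lift 1)) (y.lift 1)))

/-- `∃ X, ∀ x, (x ∈ X ↔ φ(x))`, where `x` is number variable `0` of `φ`. The other free variables
of `φ` are parameters; `X` does not occur in `φ`, due to the shift. -/
def comprehension (φ : Fml) : Fml :=
  exSet (all (iff (mem (.var 0) 0) φ.shiftSet))

/-- `∀ X, (0 ∈ X ∧ ∀ x, (x ∈ X → S x ∈ X) → ∀ x, x ∈ X)`. -/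
def setInduction : Fml :=
  allSet (imp
    (and (mem .zero 0) (all₁ fun x => imp (mem x 0) (mem (.succ x) 0)))
    (all₁ fun x => mem x 0))

/-- The axioms of `ACA₀`. -/
def ACA₀ : Set Fml :=
  {φ | EqualityAxiom φ ∨ RobinsonAxiom φ ∨
    (∃ ψ : Fml, ψ.IsArithmetical ∧ φ = comprehension ψ) ∨ φ = setInduction}

/-! ### Coding of finite objects

Below `⟨x, y⟩ = (x + y) * (x + y + 1) / 2 + y` is the Cantor pairing function. -/

/-- `p = ⟨x, y⟩`. -/
def isPair (p x y : Tm) : Fml :=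
  eq (.add p p) (.add (.mul (.add x y) (.succ (.add x y))) (.add y y))

/-- `⟨x, y⟩ ∈ X`, for a set variable `X`. -/
def pairMem (x y : Tm) (X : ℕ) : Fml :=
  ex₁ fun p => and (isPair p (x.lift 1) (y.lift 1)) (mem p X)

/-- `p = ⟨x, y⟩ + 1`. -/
def isNode (p x y : Tm) : Fml :=
  ex₁ fun q => and (isPair q (x.lift 1) (y.lift 1)) (eq (p.lift 1) (.succ q))

/-- `1 + (n + 1) * v` divides `u`: the number `n` belongs to the finite set coded by `u` and `v`
(any finite set of numbers below a given bound has such a code). -/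
def inCode (n u v : Tm) : Fml :=
  ex₁ fun q => eq (u.lift 1) (.mul q (.succ (.mul (.succ (n.lift 1)) (v.lift 1))))

/-- `⟨x, y⟩` belongs to the finite set coded by `u` and `v`. -/
def pairInCode (x y u v : Tm) : Fml :=
  ex₁ fun p => and (isPair p (x.lift 1) (y.lift 1)) (inCode p (u.lift 1) (v.lift 1))

/-- Course-of-values recursion. Suppose that `step p u v` expresses a condition on `p` which refers
to the finite set coded by `u` and `v` only through membership of numbers smaller than `p`. Then
`recursive step` is the arithmetical definition of the unique set `R` such that, for all `p`, we
have `p ∈ R` if and only if `step` holds of `p` and `R`: the number `t` lies in `R` if it lies in a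
finite set that satisfies this equivalence for all `p ≤ t`. -/
def recursive (step : Tm → Tm → Tm → Fml) (t : Tm) : Fml :=
  ex₂ fun u v => and
    (all₁ fun p => imp (le p (t.lift 3))
      (iff (inCode p (u.lift 1) (v.lift 1)) (step p (u.lift 1) (v.lift 1))))
    (inCode (t.lift 2) u v)

/-! ### Codes for the terms in `ε₀`

The finite ordered tree `⟨α₀, …, αₙ₋₁⟩` has code `0` if `n = 0`, and otherwise it has code
`⟨a, b⟩ + 1`, where `a` is the code of `α₀` and `b` is the code of `⟨α₁, …, αₙ₋₁⟩`. Every number is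
the code of exactly one finite ordered tree. -/

/-- Recursion step for the set of all `p = ⟨x, y⟩` with `x ≺ y`, i.e. for the lexicographic
comparison of finite ordered trees: `⟨⟩` is smaller than any other tree, and
`⟨x₀, …⟩ ≺ ⟨y₀, …⟩` holds if `x₀ ≺ y₀`, or if `x₀ = y₀` and the rest `x'` of the first sequence is
smaller than the rest `y'` of the second one. -/
def precStep (p u v : Tm) : Fml :=
  ex₂ fun x y => and (isPair (p.lift 2) x y) (or
    (and (eq x .zero) (not (eq y .zero)))
    (ex₄ fun x₀ x' y₀ y' => and
      (and (isNode (x.lift 4) x₀ x') (isNode (y.lift 4) y₀ y'))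
      (or (pairInCode x₀ y₀ (u.lift 6) (v.lift 6))
        (and (eq x₀ y₀) (pairInCode x' y' (u.lift 6) (v.lift 6))))))

/-- `x ≺ y`, for codes of finite ordered trees. -/
def prec (x y : Tm) : Fml :=
  ex₁ fun p => and (isPair p (x.lift 1) (y.lift 1)) (recursive precStep p)

/-- `x ≼ y`. -/
def preceq (x y : Tm) : Fml := or (prec x y) (eq x y)

/-- Recursion step for the set `ε₀`: we have `⟨⟩ ∈ ε₀`, while `⟨α₀, …, αₙ₋₁⟩` with `n > 0` lies in
`ε₀` if `x = α₀` and `y = ⟨α₁, …, αₙ₋₁⟩` do so and, in case `n > 1`, we have `α₁ ≼ α₀`. -/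
def eps0Step (p u v : Tm) : Fml :=
  or (eq p .zero)
    (ex₂ fun x y => and (isNode (p.lift 2) x y) (and
      (and (inCode x (u.lift 2) (v.lift 2)) (inCode y (u.lift 2) (v.lift 2)))
      (or (eq y .zero)
        (ex₂ fun z w => and (isNode (y.lift 2) z w) (preceq z (x.lift 2))))))

/-- `a ∈ ε₀`. -/
def inEps0 (a : Tm) : Fml := recursive eps0Step a

/-! ### Codes for binary trees

The tree `∘` has code `0`, and `∘(s, t)` has code `⟨a, b⟩ + 1`, where `a` and `b` are the codes
of `s` and `t`. -/

/-- Recursion step for the set `B` of binary trees. -/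
def treeStep (p u v : Tm) : Fml :=
  or (eq p .zero)
    (ex₂ fun s t => and (isNode (p.lift 2) s t)
      (and (inCode s (u.lift 2) (v.lift 2)) (inCode t (u.lift 2) (v.lift 2))))

/-- `s ∈ B`. -/
def inTrees (s : Tm) : Fml := recursive treeStep s

/-- Recursion step for the set of all `p = ⟨s, t⟩` with `s ≤ t` in the order on binary trees:
we have `∘ ≤ t`, and `∘(s₀, s₁) ≤ ∘(t₀, t₁)` holds if `s₀ ≤ t₀` and `s₁ ≤ t₁`, or if
`∘(s₀, s₁) ≤ t₀`, or if `∘(s₀, s₁) ≤ t₁`. -/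
def treeLeStep (p u v : Tm) : Fml :=
  ex₂ fun s t => and (isPair (p.lift 2) s t) (or
    (eq s .zero)
    (ex₄ fun s₀ s₁ t₀ t₁ => and
      (and (isNode (s.lift 4) s₀ s₁) (isNode (t.lift 4) t₀ t₁))
      (or
        (and (pairInCode s₀ t₀ (u.lift 6) (v.lift 6)) (pairInCode s₁ t₁ (u.lift 6) (v.lift 6)))
        (or (pairInCode (s.lift 4) t₀ (u.lift 6) (v.lift 6))
          (pairInCode (s.lift 4) t₁ (u.lift 6) (v.lift 6))))))

/-- `s ≤ t`, for codes of binary trees. -/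
def treeLe (s t : Tm) : Fml :=
  ex₁ fun p => and (isPair p (s.lift 1) (t.lift 1)) (recursive treeLeStep p)

/-! ### The statement about quasi-embeddings -/

/-- The set `F` is (the graph of) a function from `ε₀` to `B`. -/
def isFunction (F : ℕ) : Fml :=
  and (all₁ fun p => imp (mem p F)
      (ex₂ fun a s => and (isPair (p.lift 2) a s) (and (inEps0 a) (inTrees s))))
    (and (all₁ fun a => imp (inEps0 a) (ex₁ fun s => pairMem (a.lift 1) s F))
      (all₃ fun a s t => imp (and (pairMem a s F) (pairMem a t F)) (eq s t)))

/-- `F(⟨⟩) = ∘`, and `F(⟨α₀, …, αₙ₋₁⟩) = ∘(F(α₀), F(⟨α₁, …, αₙ₋₁⟩))` for all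
`⟨α₀, …, αₙ₋₁⟩ ∈ ε₀` with `n > 0`. -/
def satisfiesRecursion (F : ℕ) : Fml :=
  and (pairMem .zero .zero F)
    (all₃ fun a x y => imp (and (inEps0 a) (isNode a x y))
      (ex₂ fun s t => and (and (pairMem (x.lift 2) s F) (pairMem (y.lift 2) t F))
        (ex₁ fun r => and (isNode r (s.lift 1) (t.lift 1)) (pairMem (a.lift 3) r F))))

/-- `F(α) ≤ F(β)` entails `α ≼ β`, for all `α, β ∈ ε₀`. -/
def reflectsOrder (F : ℕ) : Fml :=
  all₂ fun a b => imp (and (inEps0 a) (inEps0 b))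
    (all₂ fun s t =>
      imp (and (and (pairMem (a.lift 2) s F) (pairMem (b.lift 2) t F)) (treeLe s t))
        (preceq (a.lift 2) (b.lift 2)))

/-- There is a function `F : ε₀ → B` that satisfies the given recursion and reflects the order. -/
def existsQuasiEmbedding : Fml :=
  exSet (and (isFunction 0) (and (satisfiesRecursion 0) (reflectsOrder 0)))

end SecondOrderArithmetic

namespace SecondOrderArithmetic

open Fml

namespace Tm

theorem subst_subst (σ τ : ℕ → Tm) (t : Tm) :
    (t.subst σ).subst τ = t.subst fun i => (σ i).subst τ := by
  induction t <;> simp_all [subst]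

theorem subst_var (t : Tm) : t.subst var = t := by
  induction t <;> simp_all [subst]

theorem upSubst_var : upSubst var = var := by
  funext i; cases i <;> simp [upSubst, lift, subst]

theorem upSubst_comp (σ τ : ℕ → Tm) :
    (fun i => (upSubst σ i).subst (upSubst τ)) = upSubst fun i => (σ i).subst τ := by
  funext i; cases i <;> simp [upSubst, lift, subst, subst_subst]

theorem exists_bound (t : Tm) :
    ∃ N, ∀ σ σ' : ℕ → Tm, (∀ i < N, σ i = σ' i) → t.subst σ = t.subst σ' := by
  induction t with
  | var i => exact ⟨i + 1, fun σ σ' h => h i (Nat.lt_succ_self i)⟩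
  | zero => exact ⟨0, fun _ _ _ => rfl⟩
  | succ t ih => obtain ⟨N, h⟩ := ih; exact ⟨N, fun σ σ' e => by simp [subst, h σ σ' e]⟩
  | add s t ihs iht =>
    obtain ⟨N, h⟩ := ihs; obtain ⟨K, k⟩ := iht
    exact ⟨max N K, fun σ σ' e => by
      simp [subst, h σ σ' fun i hi => e i (by omega), k σ σ' fun i hi => e i (by omega)]⟩
  | mul s t ihs iht =>
    obtain ⟨N, h⟩ := ihs; obtain ⟨K, k⟩ := iht
    exact ⟨max N K, fun σ σ' e => by
      simp [subst, h σ σ' fun i hi => e i (by omega), k σ σ' fun i hi => e i (by omega)]⟩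

end Tm

theorem upRen_id : upRen id = id := by
  funext i; cases i <;> simp [upRen]

theorem upRen_comp (ρ π : ℕ → ℕ) : (fun i => upRen π (upRen ρ i)) = upRen fun i => π (ρ i) := by
  funext i; cases i <;> simp [upRen]

namespace Fml

theorem subst_subst (φ : Fml) : ∀ (σ τ : ℕ → Tm) (ρ π : ℕ → ℕ),
    (φ.subst σ ρ).subst τ π = φ.subst (fun i => (σ i).subst τ) fun i => π (ρ i) := by
  induction φ with
  | pos a => intros; cases a <;> simp [subst, Atom.subst, Tm.subst_subst]
  | neg a => intros; cases a <;> simp [subst, Atom.subst, Tm.subst_subst]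
  | _ => intros; simp_all [subst, Tm.upSubst_comp, upRen_comp]

theorem subst_var (φ : Fml) : φ.subst Tm.var id = φ := by
  induction φ with
  | pos a => cases a <;> simp [subst, Atom.subst, Tm.subst_var]
  | neg a => cases a <;> simp [subst, Atom.subst, Tm.subst_var]
  | _ => simp_all [subst, Tm.upSubst_var, upRen_id]

theorem subst_not (φ : Fml) : ∀ (σ : ℕ → Tm) (ρ : ℕ → ℕ),
    φ.not.subst σ ρ = (φ.subst σ ρ).not := by
  induction φ <;> intros <;> simp_all [subst, not]

theorem exists_bound (φ : Fml) : ∃ N, ∀ (σ σ' : ℕ → Tm) (ρ ρ' : ℕ → ℕ),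
    (∀ i < N, σ i = σ' i) → (∀ i < N, ρ i = ρ' i) → φ.subst σ ρ = φ.subst σ' ρ' := by
  have atom (a : Atom) : ∃ N, ∀ (σ σ' : ℕ → Tm) (ρ ρ' : ℕ → ℕ),
      (∀ i < N, σ i = σ' i) → (∀ i < N, ρ i = ρ' i) → a.subst σ ρ = a.subst σ' ρ' := by
    cases a with
    | eq s t =>
      obtain ⟨N, h⟩ := s.exists_bound; obtain ⟨K, k⟩ := t.exists_bound
      exact ⟨max N K, fun σ σ' ρ ρ' e e' => by
        simp [Atom.subst, h σ σ' fun i hi => e i (by omega), k σ σ' fun i hi => e i (by omega)]⟩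
    | le s t =>
      obtain ⟨N, h⟩ := s.exists_bound; obtain ⟨K, k⟩ := t.exists_bound
      exact ⟨max N K, fun σ σ' ρ ρ' e e' => by
        simp [Atom.subst, h σ σ' fun i hi => e i (by omega), k σ σ' fun i hi => e i (by omega)]⟩
    | mem t X =>
      obtain ⟨N, h⟩ := t.exists_bound
      exact ⟨max N (X + 1), fun σ σ' ρ ρ' e e' => by
        simp [Atom.subst, h σ σ' fun i hi => e i (by omega), e' X (by omega)]⟩
  induction φ with
  | pos a => obtain ⟨N, h⟩ := atom a; exact ⟨N, fun σ σ' ρ ρ' e e' => by simp [subst, h _ _ _ _ e e']⟩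
  | neg a => obtain ⟨N, h⟩ := atom a; exact ⟨N, fun σ σ' ρ ρ' e e' => by simp [subst, h _ _ _ _ e e']⟩
  | and φ ψ ih₁ ih₂ | or φ ψ ih₁ ih₂ =>
    obtain ⟨N, h⟩ := ih₁; obtain ⟨K, k⟩ := ih₂
    exact ⟨max N K, fun σ σ' ρ ρ' e e' => by
      simp only [subst]
      rw [h σ σ' ρ ρ' (fun i hi => e i (by omega)) (fun i hi => e' i (by omega)),
        k σ σ' ρ ρ' (fun i hi => e i (by omega)) (fun i hi => e' i (by omega))]⟩
  | all φ ih | ex φ ih =>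
    obtain ⟨N, h⟩ := ih
    refine ⟨N, fun σ σ' ρ ρ' e e' => ?_⟩
    simp only [subst]
    rw [h (Tm.upSubst σ) (Tm.upSubst σ') ρ ρ' (fun i hi => ?_) e']
    cases i with
    | zero => rfl
    | succ i => simp [Tm.upSubst, e i (by omega)]
  | allSet φ ih | exSet φ ih =>
    obtain ⟨N, h⟩ := ih
    refine ⟨N, fun σ σ' ρ ρ' e e' => ?_⟩
    simp only [subst]
    rw [h σ σ' (upRen ρ) (upRen ρ') e (fun i hi => ?_)]
    cases i with
    | zero => rfl
    | succ i => simp [upRen, e' i (by omega)]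

theorem exists_bound_list (Γ : List Fml) : ∃ N, ∀ φ ∈ Γ, ∀ (σ σ' : ℕ → Tm) (ρ ρ' : ℕ → ℕ),
    (∀ i < N, σ i = σ' i) → (∀ i < N, ρ i = ρ' i) → φ.subst σ ρ = φ.subst σ' ρ' := by
  induction Γ with
  | nil => exact ⟨0, by simp⟩
  | cons ψ Γ ih =>
    obtain ⟨N, h⟩ := ih; obtain ⟨K, k⟩ := ψ.exists_bound
    refine ⟨max N K, fun φ hφ σ σ' ρ ρ' e e' => ?_⟩
    rcases List.mem_cons.1 hφ with rfl | hφ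
    · exact k _ _ _ _ (fun i hi => e i (by omega)) (fun i hi => e' i (by omega))
    · exact h φ hφ _ _ _ _ (fun i hi => e i (by omega)) (fun i hi => e' i (by omega))

theorem shift_subst (φ : Fml) (σ : ℕ → Tm) (ρ : ℕ → ℕ) :
    φ.shift.subst (Tm.upSubst σ) ρ = (φ.subst σ ρ).shift := by
  simp [shift, subst_subst, Tm.subst, Tm.upSubst, Tm.lift]

theorem shiftSet_subst (φ : Fml) (σ : ℕ → Tm) (ρ : ℕ → ℕ) :
    φ.shiftSet.subst σ (upRen ρ) = (φ.subst σ ρ).shiftSet := by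
  simp [shiftSet, subst_subst, Tm.subst, upRen, Tm.subst_var]

theorem subst_up_inst (φ : Fml) (σ : ℕ → Tm) (ρ : ℕ → ℕ) (t : Tm) :
    (φ.subst (Tm.upSubst σ) ρ).inst t = φ.subst (fun i => Nat.casesOn i t σ) ρ := by
  rw [inst, subst_subst]
  congr 1
  funext i; cases i <;> simp [Tm.subst, Tm.upSubst, Tm.lift, Tm.subst_subst, Tm.subst_var]

theorem subst_up_instSet (φ : Fml) (σ : ℕ → Tm) (ρ : ℕ → ℕ) (X : ℕ) :
    (φ.subst σ (upRen ρ)).instSet X = φ.subst σ fun i => Nat.casesOn i X ρ := by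
  rw [instSet, subst_subst]
  congr 1
  · funext i; simp [Tm.subst_var]
  · funext i; cases i <;> simp [upRen]

theorem inst_subst (φ : Fml) (t : Tm) (σ : ℕ → Tm) (ρ : ℕ → ℕ) :
    (φ.inst t).subst σ ρ = (φ.subst (Tm.upSubst σ) ρ).inst (t.subst σ) := by
  rw [subst_up_inst, inst, subst_subst]
  congr 1
  funext i; cases i <;> simp [Tm.subst]

theorem instSet_subst (φ : Fml) (X : ℕ) (σ : ℕ → Tm) (ρ : ℕ → ℕ) :
    (φ.instSet X).subst σ ρ = (φ.subst σ (upRen ρ)).instSet (ρ X) := by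
  rw [subst_up_instSet, instSet, subst_subst]
  congr 1
  funext i; cases i <;> simp

end Fml

namespace Derivable

variable {T : Set Fml}

theorem weaken {Γ Δ : List Fml} (d : Derivable T Γ) (h : Γ ⊆ Δ) : Derivable T Δ := by
  induction d generalizing Δ with
  | ax hT hm => exact .ax hT (h hm)
  | lit hp hn => exact .lit (h hp) (h hn)
  | and hm _ _ ih₀ ih₁ =>
    exact .and (h hm) (ih₀ (List.cons_subset_cons _ h)) (ih₁ (List.cons_subset_cons _ h))
  | orLeft hm _ ih => exact .orLeft (h hm) (ih (List.cons_subset_cons _ h))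
  | orRight hm _ ih => exact .orRight (h hm) (ih (List.cons_subset_cons _ h))
  | all hm _ ih => exact .all (h hm) (ih (List.cons_subset_cons _ (List.map_subset _ h)))
  | ex t hm _ ih => exact .ex t (h hm) (ih (List.cons_subset_cons _ h))
  | allSet hm _ ih => exact .allSet (h hm) (ih (List.cons_subset_cons _ (List.map_subset _ h)))
  | exSet X hm _ ih => exact .exSet X (h hm) (ih (List.cons_subset_cons _ h))
  | cut φ _ _ ih₀ ih₁ =>
    exact .cut φ (ih₀ (List.cons_subset_cons _ h)) (ih₁ (List.cons_subset_cons _ h))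

theorem subst (hT : ∀ φ ∈ T, ∀ σ ρ, φ.subst σ ρ ∈ T) {Γ : List Fml} (d : Derivable T Γ) :
    ∀ (σ : ℕ → Tm) (ρ : ℕ → ℕ), Derivable T (Γ.map (Fml.subst σ ρ)) := by
  induction d with
  | ax hφ hm => exact fun σ ρ => .ax (hT _ hφ σ ρ) (List.mem_map_of_mem hm)
  | lit hp hn =>
    exact fun σ ρ => .lit (List.mem_map_of_mem (f := Fml.subst σ ρ) hp)
      (List.mem_map_of_mem (f := Fml.subst σ ρ) hn)
  | and hm _ _ ih₀ ih₁ =>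
    exact fun σ ρ => .and (List.mem_map_of_mem (f := Fml.subst σ ρ) hm) (ih₀ σ ρ) (ih₁ σ ρ)
  | orLeft hm _ ih =>
    exact fun σ ρ => .orLeft (List.mem_map_of_mem (f := Fml.subst σ ρ) hm) (ih σ ρ)
  | orRight hm _ ih =>
    exact fun σ ρ => .orRight (List.mem_map_of_mem (f := Fml.subst σ ρ) hm) (ih σ ρ)
  | all hm _ ih =>
    intro σ ρ
    refine .all (List.mem_map_of_mem (f := Fml.subst σ ρ) hm) ?_
    simpa [Function.comp_def, shift_subst] using ih (Tm.upSubst σ) ρ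
  | ex t hm _ ih =>
    intro σ ρ
    refine .ex (t.subst σ) (List.mem_map_of_mem (f := Fml.subst σ ρ) hm) ?_
    simpa [inst_subst] using ih σ ρ
  | allSet hm _ ih =>
    intro σ ρ
    refine .allSet (List.mem_map_of_mem (f := Fml.subst σ ρ) hm) ?_
    simpa [Function.comp_def, shiftSet_subst] using ih σ (upRen ρ)
  | exSet X hm _ ih =>
    intro σ ρ
    refine .exSet (ρ X) (List.mem_map_of_mem (f := Fml.subst σ ρ) hm) ?_
    simpa [instSet_subst] using ih σ ρ
  | cut φ _ _ ih₀ ih₁ =>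
    intro σ ρ
    exact .cut (φ.subst σ ρ) (ih₀ σ ρ) (by simpa [subst_not] using ih₁ σ ρ)

/-- A universal formula may be refuted by a fresh variable. -/
theorem exists_fresh (hT : ∀ φ ∈ T, ∀ σ ρ, φ.subst σ ρ ∈ T) {Γ : List Fml} {φ : Fml}
    (h : Fml.all φ ∈ Γ) : ∃ x, Derivable T (φ.inst (.var x) :: Γ) → Derivable T Γ := by
  obtain ⟨N, hN⟩ := exists_bound_list (φ :: Γ)
  refine ⟨N, fun d => .all h ?_⟩
  convert d.subst hT (fun i => if i = N then .var 0 else .var (i + 1)) id using 1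
  rw [List.map_cons]
  congr 1
  · rw [inst, subst_subst]
    refine (subst_var φ).symm.trans (hN φ (by simp) _ _ _ _ (fun i hi => ?_) fun i hi => rfl)
    cases i with
    | zero => simp [Tm.subst]
    | succ i => simp [Tm.subst, show i ≠ N by omega]
  · refine List.map_congr_left fun ψ hψ => hN ψ (by simp [hψ]) _ _ _ _ (fun i hi => ?_) fun _ _ => rfl
    simp [show i ≠ N by omega]

theorem exists_freshSet (hT : ∀ φ ∈ T, ∀ σ ρ, φ.subst σ ρ ∈ T) {Γ : List Fml} {φ : Fml}
    (h : Fml.allSet φ ∈ Γ) : ∃ X, Derivable T (φ.instSet X :: Γ) → Derivable T Γ := by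
  obtain ⟨N, hN⟩ := exists_bound_list (φ :: Γ)
  refine ⟨N, fun d => .allSet h ?_⟩
  convert d.subst hT .var (fun i => if i = N then 0 else i + 1) using 1
  rw [List.map_cons]
  congr 1
  · rw [instSet, subst_subst]
    refine (subst_var φ).symm.trans (hN φ (by simp) _ _ _ _ (fun i hi => rfl) fun i hi => ?_)
    cases i with
    | zero => simp
    | succ i => simp [show i ≠ N by omega]
  · refine List.map_congr_left fun ψ hψ => hN ψ (by simp [hψ]) _ _ _ _ (fun _ _ => rfl) fun i hi => ?_
    simp [show i ≠ N by omega]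

end Derivable

/-! ### Countability of the language -/

def Tm.code : Tm → ℕ
  | var i => Nat.pair 0 i
  | zero => Nat.pair 1 0
  | succ t => Nat.pair 2 t.code
  | add s t => Nat.pair 3 (Nat.pair s.code t.code)
  | mul s t => Nat.pair 4 (Nat.pair s.code t.code)

theorem Tm.code_injective : Function.Injective Tm.code := by
  intro s
  induction s <;> intro t h <;> cases t <;> simp [Tm.code, Nat.pair_eq_pair] at h ⊢ <;> grind

def Atom.code : Atom → ℕ
  | eq s t => Nat.pair 0 (Nat.pair s.code t.code)
  | le s t => Nat.pair 1 (Nat.pair s.code t.code)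
  | mem t X => Nat.pair 2 (Nat.pair t.code X)

theorem Atom.code_injective : Function.Injective Atom.code := by
  intro a b h
  cases a <;> cases b <;>
    simp_all [Atom.code, Nat.pair_eq_pair, Tm.code_injective.eq_iff]

def Fml.code : Fml → ℕ
  | pos a => Nat.pair 0 a.code
  | neg a => Nat.pair 1 a.code
  | and φ ψ => Nat.pair 2 (Nat.pair φ.code ψ.code)
  | or φ ψ => Nat.pair 3 (Nat.pair φ.code ψ.code)
  | all φ => Nat.pair 4 φ.code
  | ex φ => Nat.pair 5 φ.code
  | allSet φ => Nat.pair 6 φ.code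
  | exSet φ => Nat.pair 7 φ.code

theorem Fml.code_injective : Function.Injective Fml.code := by
  intro s
  induction s <;> intro t h <;> cases t <;>
    simp [Fml.code, Nat.pair_eq_pair, Atom.code_injective.eq_iff] at h ⊢ <;> grind

/-! ### Structures for the language -/

/-- A structure for the language of second order arithmetic, in which equality need not be
interpreted as equality. -/
structure Str where
  M : Type
  S : Type
  zero : M
  succ : M → M
  add : M → M → M
  mul : M → M → M
  eq : M → M → Prop
  le : M → M → Prop
  mem : M → S → Prop

/-- Extend an assignment by a value for variable `0`. -/
def cons {α : Type} (a : α) (e : ℕ → α) : ℕ → α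
  | 0 => a
  | i + 1 => e i

@[simp] theorem cons_zero {α : Type} (a : α) (e : ℕ → α) : cons a e 0 = a := rfl

@[simp] theorem cons_succ {α : Type} (a : α) (e : ℕ → α) (i : ℕ) : cons a e (i + 1) = e i := rfl

@[simp] theorem cons_one {α : Type} (a : α) (e : ℕ → α) : cons a e 1 = e 0 := rfl

/-- The value of a term. -/
def Tm.val (A : Str) (e : ℕ → A.M) : Tm → A.M
  | var i => e i
  | zero => A.zero
  | succ t => A.succ (t.val A e)
  | add s t => A.add (s.val A e) (t.val A e)
  | mul s t => A.mul (s.val A e) (t.val A e)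

/-- Satisfaction of prime formulas. -/
def Atom.Sat (A : Str) (e : ℕ → A.M) (E : ℕ → A.S) : Atom → Prop
  | eq s t => A.eq (s.val A e) (t.val A e)
  | le s t => A.le (s.val A e) (t.val A e)
  | mem t X => A.mem (t.val A e) (E X)

/-- Tarski satisfaction. -/
def Fml.Sat (A : Str) : (ℕ → A.M) → (ℕ → A.S) → Fml → Prop
  | e, E, pos a => a.Sat A e E
  | e, E, neg a => ¬ a.Sat A e E
  | e, E, and φ ψ => Sat A e E φ ∧ Sat A e E ψ
  | e, E, or φ ψ => Sat A e E φ ∨ Sat A e E ψ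
  | e, E, all φ => ∀ m, Sat A (cons m e) E φ
  | e, E, ex φ => ∃ m, Sat A (cons m e) E φ
  | e, E, allSet φ => ∀ X, Sat A e (cons X E) φ
  | e, E, exSet φ => ∃ X, Sat A e (cons X E) φ

/-- All formulas in `T` hold under all assignments. -/
def Str.Models (A : Str) (T : Set Fml) : Prop := ∀ φ ∈ T, ∀ e E, φ.Sat A e E

theorem Fml.sat_not (A : Str) (φ : Fml) : ∀ e E, φ.not.Sat A e E ↔ ¬ φ.Sat A e E := by
  induction φ <;> intros <;> simp_all [Fml.not, Fml.Sat, imp_iff_not_or]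

/-! ### Completeness -/

variable {T : Set Fml}

theorem exists_extension (hT : ∀ φ ∈ T, ∀ σ ρ, φ.subst σ ρ ∈ T) {Γ : List Fml}
    (hΓ : ¬ Derivable T Γ) (φ : Fml) : ∃ Δ, ¬ Derivable T Δ ∧ Γ ⊆ Δ ∧
      ((φ ∈ Δ ∧ (∀ ψ, φ = all ψ → ∃ x, ψ.inst (.var x) ∈ Δ) ∧
        (∀ ψ, φ = allSet ψ → ∃ X, ψ.instSet X ∈ Δ)) ∨
      (φ.not ∈ Δ ∧ Derivable T (φ :: Γ))) := by
  by_cases h : Derivable T (φ :: Γ)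
  · exact ⟨φ.not :: Γ, fun h' => hΓ (.cut φ h h'), by simp, .inr ⟨by simp, h⟩⟩
  · by_cases h₁ : ∃ ψ, φ = all ψ
    · obtain ⟨ψ, rfl⟩ := h₁
      obtain ⟨x, hx⟩ := Derivable.exists_fresh hT (Γ := all ψ :: Γ) (φ := ψ) (by simp)
      refine ⟨_, fun d => h (hx d), fun χ hχ => by simp [hχ], .inl ⟨by simp, ?_, by simp⟩⟩
      rintro _ ⟨⟩
      exact ⟨x, by simp⟩
    by_cases h₂ : ∃ ψ, φ = allSet ψ
    · obtain ⟨ψ, rfl⟩ := h₂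
      obtain ⟨X, hX⟩ := Derivable.exists_freshSet hT (Γ := allSet ψ :: Γ) (φ := ψ) (by simp)
      refine ⟨_, fun d => h (hX d), fun χ hχ => by simp [hχ], .inl ⟨by simp, by simp, ?_⟩⟩
      rintro _ ⟨⟩
      exact ⟨X, by simp⟩
    · exact ⟨φ :: Γ, h, by simp, .inl ⟨by simp, fun ψ e => (h₁ ⟨ψ, e⟩).elim,
        fun ψ e => (h₂ ⟨ψ, e⟩).elim⟩⟩

/-- A maximal set of formulas that can be refuted simultaneously, with Henkin witnesses. -/
structure IsHenkin (T U : Set Fml) : Prop where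
  consistent : ∀ Δ : List Fml, (∀ φ ∈ Δ, φ ∈ U) → ¬ Derivable T Δ
  maximal : ∀ φ ∉ U, ∃ Δ : List Fml, (∀ ψ ∈ Δ, ψ ∈ U) ∧ Derivable T (φ :: Δ)
  complete : ∀ φ ∉ U, φ.not ∈ U
  witness : ∀ φ, all φ ∈ U → ∃ x, φ.inst (.var x) ∈ U
  witnessSet : ∀ φ, allSet φ ∈ U → ∃ X, φ.instSet X ∈ U

theorem exists_isHenkin (hT : ∀ φ ∈ T, ∀ σ ρ, φ.subst σ ρ ∈ T) {Γ : List Fml}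
    (hΓ : ¬ Derivable T Γ) : ∃ U, IsHenkin T U ∧ ∀ φ ∈ Γ, φ ∈ U := by
  have : Countable Fml := Fml.code_injective.countable
  have : Nonempty Fml := ⟨.pos (.eq .zero .zero)⟩
  obtain ⟨f, hf⟩ := exists_surjective_nat Fml
  choose ext hext using fun (Γ : {Γ : List Fml // ¬ Derivable T Γ}) φ =>
    exists_extension hT Γ.2 φ
  let G : ℕ → {Γ : List Fml // ¬ Derivable T Γ} := fun n =>
    Nat.rec ⟨Γ, hΓ⟩ (fun n Δ => ⟨ext Δ (f n), (hext Δ (f n)).1⟩) n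
  have hG (n : ℕ) : (G (n + 1)).1 = ext (G n) (f n) := rfl
  have mono {m n : ℕ} (h : m ≤ n) : (G m).1 ⊆ (G n).1 := by
    induction h with
    | refl => exact fun _ h => h
    | step _ ih => exact fun φ h => (hext (G _) (f _)).2.1 (ih h)
  have cons : ∀ Δ : List Fml, (∀ φ ∈ Δ, φ ∈ {φ | ∃ n, φ ∈ (G n).1}) → ¬ Derivable T Δ := by
    intro Δ hΔ d
    have : ∃ n, Δ ⊆ (G n).1 := by
      clear d
      induction Δ with
      | nil => exact ⟨0, by simp⟩
      | cons φ Δ ih =>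
        obtain ⟨n, hn⟩ := ih fun ψ hψ => hΔ ψ (by simp [hψ])
        obtain ⟨k, hk⟩ := hΔ φ (by simp)
        refine ⟨max n k, fun ψ hψ => ?_⟩
        rcases List.mem_cons.1 hψ with rfl | hψ
        · exact mono (le_max_right _ _) hk
        · exact mono (le_max_left _ _) (hn hψ)
    obtain ⟨n, hn⟩ := this
    exact (G n).2 (d.weaken hn)
  have absurd_of (φ : Fml) (hφ : ∃ n, φ ∈ (G n).1) (n : ℕ) : ¬ Derivable T (φ :: (G n).1) := by
    refine cons _ fun ψ hψ => ?_
    rcases List.mem_cons.1 hψ with rfl | hψ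
    exacts [hφ, ⟨n, hψ⟩]
  refine ⟨{φ | ∃ n, φ ∈ (G n).1}, ⟨cons, ?_, ?_, ?_, ?_⟩, fun φ h => ⟨0, h⟩⟩
  · intro φ hφ
    obtain ⟨n, rfl⟩ := hf φ
    rcases (hext (G n) (f n)).2.2 with h | h
    · exact (hφ ⟨n + 1, h.1⟩).elim
    · exact ⟨(G n).1, fun ψ hψ => ⟨n, hψ⟩, h.2⟩
  · intro φ hφ
    obtain ⟨n, rfl⟩ := hf φ
    rcases (hext (G n) (f n)).2.2 with h | h
    · exact (hφ ⟨n + 1, h.1⟩).elim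
    · exact ⟨n + 1, h.1⟩
  · intro φ hφ
    obtain ⟨n, hn⟩ := hf (all φ)
    rcases (hext (G n) (f n)).2.2 with h | h
    · obtain ⟨x, hx⟩ := h.2.1 φ hn
      exact ⟨x, n + 1, hx⟩
    · exact (absurd_of _ (hn ▸ hφ) n h.2).elim
  · intro φ hφ
    obtain ⟨n, hn⟩ := hf (allSet φ)
    rcases (hext (G n) (f n)).2.2 with h | h
    · obtain ⟨x, hx⟩ := h.2.2 φ hn
      exact ⟨x, n + 1, hx⟩
    · exact (absurd_of _ (hn ▸ hφ) n h.2).elim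

/-- The term structure in which precisely the prime formulas in `U` are false. -/
def termStr (U : Set Fml) : Str where
  M := Tm
  S := ℕ
  zero := .zero
  succ := .succ
  add := .add
  mul := .mul
  eq s t := pos (.eq s t) ∉ U
  le s t := pos (.le s t) ∉ U
  mem t X := pos (.mem t X) ∉ U

theorem val_termStr (U : Set Fml) (σ : ℕ → Tm) (t : Tm) : t.val (termStr U) σ = t.subst σ := by
  induction t <;> simp_all [Tm.val, Tm.subst, termStr]

theorem atomSat_termStr (U : Set Fml) (σ : ℕ → Tm) (ρ : ℕ → ℕ) (a : Atom) :
    a.Sat (termStr U) σ ρ ↔ pos (a.subst σ ρ) ∉ U := by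
  cases a <;> simp only [Atom.Sat, val_termStr, Atom.subst] <;> rfl

theorem IsHenkin.not_sat {U : Set Fml} (hU : IsHenkin T U) (φ : Fml) :
    ∀ (σ : ℕ → Tm) (ρ : ℕ → ℕ), φ.subst σ ρ ∈ U → ¬ φ.Sat (termStr U) σ ρ := by
  have up (σ : ℕ → Tm) (t : Tm) : (fun i => Nat.casesOn i t σ : ℕ → Tm) = cons t σ := by
    funext i; cases i <;> rfl
  have upSet (ρ : ℕ → ℕ) (X : ℕ) : (fun i => Nat.casesOn i X ρ : ℕ → ℕ) = cons X ρ := by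
    funext i; cases i <;> rfl
  induction φ with
  | pos a =>
    intro σ ρ h h'
    exact (atomSat_termStr U σ ρ a).1 h' h
  | neg a =>
    intro σ ρ h h'
    replace h' := not_not.1 (mt (atomSat_termStr U σ ρ a).2 h')
    exact hU.consistent [pos (a.subst σ ρ), neg (a.subst σ ρ)] (by simpa [h', subst] using h)
      (.lit (a := a.subst σ ρ) (by simp) (by simp))
  | and φ ψ ih₁ ih₂ =>
    rintro σ ρ h ⟨h₁, h₂⟩
    obtain ⟨Δ₁, k₁, d₁⟩ := hU.maximal _ fun h' => ih₁ σ ρ h' h₁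
    obtain ⟨Δ₂, k₂, d₂⟩ := hU.maximal _ fun h' => ih₂ σ ρ h' h₂
    refine hU.consistent ((φ.and ψ).subst σ ρ :: (Δ₁ ++ Δ₂)) ?_
      (.and (φ := φ.subst σ ρ) (ψ := ψ.subst σ ρ) (by simp [subst])
        (d₁.weaken fun _ => ?_) (d₂.weaken fun _ => ?_))
    · simp only [List.mem_cons, List.mem_append]; grind
    · simp only [List.mem_cons, List.mem_append]; grind
    · simp only [List.mem_cons, List.mem_append]; grind
  | or φ ψ ih₁ ih₂ =>
    rintro σ ρ h (h' | h')
    · obtain ⟨Δ, k, d⟩ := hU.maximal _ fun h => ih₁ σ ρ h h'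
      refine hU.consistent ((φ.or ψ).subst σ ρ :: Δ) (by simpa [h] using k)
        (.orLeft (φ := φ.subst σ ρ) (ψ := ψ.subst σ ρ) (by simp [subst]) (d.weaken fun _ => ?_))
      simp only [List.mem_cons]; grind
    · obtain ⟨Δ, k, d⟩ := hU.maximal _ fun h => ih₂ σ ρ h h'
      refine hU.consistent ((φ.or ψ).subst σ ρ :: Δ) (by simpa [h] using k)
        (.orRight (φ := φ.subst σ ρ) (ψ := ψ.subst σ ρ) (by simp [subst]) (d.weaken fun _ => ?_))
      simp only [List.mem_cons]; grind
  | all φ ih =>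
    intro σ ρ h h'
    obtain ⟨x, hx⟩ := hU.witness _ h
    rw [subst_up_inst, up] at hx
    exact ih _ _ hx (h' _)
  | ex φ ih =>
    rintro σ ρ h ⟨(t : Tm), h'⟩
    obtain ⟨Δ, k, d⟩ := hU.maximal _ fun h => ih (cons (α := Tm) t σ) ρ h h'
    refine hU.consistent ((Fml.ex φ).subst σ ρ :: Δ) (by simpa [h] using k)
      (.ex (φ := φ.subst (Tm.upSubst σ) ρ) t (by simp [subst]) (d.weaken fun _ => ?_))
    rw [subst_up_inst, up]
    simp only [List.mem_cons]; grind
  | allSet φ ih =>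
    intro σ ρ h h'
    obtain ⟨x, hx⟩ := hU.witnessSet _ h
    rw [subst_up_instSet, upSet] at hx
    exact ih _ _ hx (h' _)
  | exSet φ ih =>
    rintro σ ρ h ⟨(X : ℕ), h'⟩
    obtain ⟨Δ, k, d⟩ := hU.maximal _ fun h => ih σ (cons (α := ℕ) X ρ) h h'
    refine hU.consistent ((Fml.exSet φ).subst σ ρ :: Δ) (by simpa [h] using k)
      (.exSet (φ := φ.subst σ (upRen ρ)) X (by simp [subst]) (d.weaken fun _ => ?_))
    rw [subst_up_instSet, upSet]
    simp only [List.mem_cons]; grind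

theorem proves_of_forall_models (hT : ∀ φ ∈ T, ∀ σ ρ, φ.subst σ ρ ∈ T) {φ : Fml}
    (h : ∀ A : Str, A.Models T → ∀ e E, φ.Sat A e E) : Proves T φ := by
  by_contra hφ
  obtain ⟨U, hU, hφU⟩ := exists_isHenkin hT hφ
  refine hU.not_sat φ Tm.var id (by simpa [subst_var] using hφU) (h _ (fun ψ hψ σ ρ => ?_) _ _)
  by_contra hs
  have : ψ.subst σ ρ ∉ U := fun h' =>
    hU.consistent [ψ.subst σ ρ] (by simpa using h') (.ax (hT _ hψ σ ρ) (by simp))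
  exact hU.not_sat ψ.not σ ρ (subst_not ψ σ ρ ▸ hU.complete _ this) ((sat_not _ _ _ _).2 hs)

/-! ### Structures with equality -/

namespace Str

/-- The equality axioms, read in a structure. -/
structure EqCongr (A : Str) : Prop where
  refl : ∀ x, A.eq x x
  symm : ∀ x y, A.eq x y → A.eq y x
  trans : ∀ x y z, A.eq x y → A.eq y z → A.eq x z
  succ : ∀ x y, A.eq x y → A.eq (A.succ x) (A.succ y)
  add : ∀ x x' y y', A.eq x x' → A.eq y y' → A.eq (A.add x y) (A.add x' y')
  mul : ∀ x x' y y', A.eq x x' → A.eq y y' → A.eq (A.mul x y) (A.mul x' y')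
  le : ∀ x x' y y', A.eq x x' → A.eq y y' → A.le x y → A.le x' y'
  mem : ∀ X x y, A.eq x y → A.mem x X → A.mem y X

variable {A : Str}

def EqCongr.setoid (h : A.EqCongr) : Setoid A.M := ⟨A.eq, ⟨h.refl, h.symm _ _, h.trans _ _ _⟩⟩

/-- The quotient of a structure by its equality relation. -/
def EqCongr.quot (h : A.EqCongr) : Str where
  M := Quotient h.setoid
  S := A.S
  zero := Quotient.mk _ A.zero
  succ := Quotient.map A.succ fun _ _ => h.succ _ _
  add := Quotient.map₂ A.add fun _ _ p _ _ q => h.add _ _ _ _ p q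
  mul := Quotient.map₂ A.mul fun _ _ p _ _ q => h.mul _ _ _ _ p q
  eq := Eq
  le := Quotient.lift₂ A.le fun _ _ _ _ p q =>
    propext ⟨h.le _ _ _ _ p q, h.le _ _ _ _ (h.symm _ _ p) (h.symm _ _ q)⟩
  mem x X := Quotient.lift (A.mem · X) (fun _ _ p => propext ⟨h.mem X _ _ p,
    h.mem X _ _ (h.symm _ _ p)⟩) x

def EqCongr.mk' (h : A.EqCongr) (x : A.M) : h.quot.M := Quotient.mk h.setoid x

theorem EqCongr.mk'_surjective (h : A.EqCongr) : Function.Surjective h.mk' :=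
  Quotient.mk_surjective

theorem EqCongr.val_quot (h : A.EqCongr) (e : ℕ → A.M) (t : Tm) :
    t.val h.quot (fun i => h.mk' (e i)) = h.mk' (t.val A e) := by
  induction t <;> simp only [Tm.val, *] <;> rfl

theorem EqCongr.atomSat_quot (h : A.EqCongr) (e : ℕ → A.M) (E : ℕ → A.S) (a : Atom) :
    a.Sat h.quot (fun i => h.mk' (e i)) E ↔ a.Sat A e E := by
  cases a <;> simp only [Atom.Sat, h.val_quot]
  · exact Quotient.eq (r := h.setoid)
  · rfl
  · rfl

theorem EqCongr.sat_quot (h : A.EqCongr) (φ : Fml) : ∀ (e : ℕ → A.M) (E : ℕ → A.S),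
    φ.Sat h.quot (fun i => h.mk' (e i)) E ↔ φ.Sat A e E := by
  have up (m : A.M) (e : ℕ → A.M) :
      (cons (h.mk' m) fun i => h.mk' (e i)) = fun i => h.mk' (cons m e i) := by
    funext i; cases i <;> rfl
  induction φ with
  | pos a => intro e E; simp [Fml.Sat, h.atomSat_quot]
  | neg a => intro e E; simp [Fml.Sat, h.atomSat_quot]
  | and φ ψ ih₁ ih₂ | or φ ψ ih₁ ih₂ => intro e E; simp [Fml.Sat, ih₁, ih₂]
  | all φ ih =>
    intro e E
    simp only [Fml.Sat, h.mk'_surjective.forall, up, ih]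
  | ex φ ih =>
    intro e E
    simp only [Fml.Sat, h.mk'_surjective.exists, up, ih]
  | allSet φ ih => intro e E; exact forall_congr' fun X => ih e _
  | exSet φ ih => intro e E; exact exists_congr fun X => ih e _

theorem EqCongr.models_quot (h : A.EqCongr) (hA : A.Models T) : h.quot.Models T := by
  intro φ hφ e E
  obtain ⟨e, rfl⟩ : ∃ e' : ℕ → A.M, e = fun i => h.mk' (e' i) :=
    ⟨fun i => (h.mk'_surjective (e i)).choose,
      funext fun i => (h.mk'_surjective (e i)).choose_spec.symm⟩
  exact (h.sat_quot φ e E).2 (hA φ hφ e E)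

theorem Models.eqCongr (hT : ∀ φ, EqualityAxiom φ → φ ∈ T) (hA : A.Models T) (x₀ : A.M)
    (X₀ : A.S) : A.EqCongr where
  refl := hA _ (hT _ .refl) (fun _ => x₀) fun _ => X₀
  symm := by
    simpa [all₂, imp, Fml.Sat, sat_not, Atom.Sat, Tm.val, Fml.eq, imp_iff_not_or]
      using hA _ (hT _ .symm) (fun _ => x₀) fun _ => X₀
  trans := by
    simpa [all₃, imp, Fml.Sat, sat_not, Atom.Sat, Tm.val, Fml.eq, imp_iff_not_or, or_assoc, cons]
      using hA _ (hT _ .trans) (fun _ => x₀) fun _ => X₀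
  succ := by
    simpa [all₂, imp, Fml.Sat, sat_not, Atom.Sat, Tm.val, Fml.eq, imp_iff_not_or]
      using hA _ (hT _ .succ) (fun _ => x₀) fun _ => X₀
  add := by
    simpa [all₄, imp, Fml.Sat, sat_not, Atom.Sat, Tm.val, Fml.eq, imp_iff_not_or, or_assoc, cons]
      using hA _ (hT _ .add) (fun _ => x₀) fun _ => X₀
  mul := by
    simpa [all₄, imp, Fml.Sat, sat_not, Atom.Sat, Tm.val, Fml.eq, imp_iff_not_or, or_assoc, cons]
      using hA _ (hT _ .mul) (fun _ => x₀) fun _ => X₀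
  le := by
    simpa [all₄, imp, Fml.Sat, sat_not, Atom.Sat, Tm.val, Fml.eq, Fml.le, imp_iff_not_or, or_assoc, cons]
      using hA _ (hT _ .le) (fun _ => x₀) fun _ => X₀
  mem := by
    simpa [all₂, imp, Fml.Sat, sat_not, Atom.Sat, Tm.val, Fml.eq, Fml.mem, imp_iff_not_or, or_assoc]
      using hA _ (hT _ .mem) (fun _ => x₀) fun _ => X₀

end Str

/-! ### Completeness for `ACA₀` -/

theorem Fml.IsArithmetical.subst {φ : Fml} (h : φ.IsArithmetical) :
    ∀ (σ : ℕ → Tm) (ρ : ℕ → ℕ), (φ.subst σ ρ).IsArithmetical := by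
  induction φ <;> intros <;> simp_all [IsArithmetical, Fml.subst]

theorem ACA₀_subst (φ : Fml) (hφ : φ ∈ ACA₀) (σ : ℕ → Tm) (ρ : ℕ → ℕ) : φ.subst σ ρ ∈ ACA₀ := by
  rcases hφ with h | h | ⟨ψ, h, rfl⟩ | rfl
  · have : φ.subst σ ρ = φ := by cases h <;> rfl
    exact this.symm ▸ .inl h
  · have : φ.subst σ ρ = φ := by cases h <;> rfl
    exact this.symm ▸ .inr (.inl h)
  · refine .inr (.inr (.inl ⟨ψ.subst (Tm.upSubst σ) ρ, h.subst _ _, ?_⟩))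
    simp only [comprehension, iff, imp, Fml.subst, subst_not, ← shiftSet_subst]
    rfl
  · exact .inr (.inr (.inr rfl))

/-- To prove a sentence in `ACA₀`, it suffices to show that it holds in all models in which equality
is interpreted by equality. -/
theorem proves_ACA₀_of_forall_models {φ : Fml}
    (h : ∀ A : Str, (∀ x y, A.eq x y ↔ x = y) → A.Models ACA₀ → ∀ e E, φ.Sat A e E) :
    Proves ACA₀ φ := by
  refine proves_of_forall_models ACA₀_subst fun A hA e E => ?_
  have hc : A.EqCongr := hA.eqCongr (fun _ h => .inl h) A.zero (E 0)
  exact (hc.sat_quot φ e E).1 (h hc.quot (fun _ _ => Iff.rfl) (hc.models_quot hA) _ _)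

/-! ### Satisfaction and substitution -/

theorem cons_eta {α : Type} (e : ℕ → α) : cons (e 0) (fun i => e (i + 1)) = e := by
  funext i; cases i <;> rfl

theorem Tm.val_subst (A : Str) (e : ℕ → A.M) (σ : ℕ → Tm) (t : Tm) :
    (t.subst σ).val A e = t.val A fun i => (σ i).val A e := by
  induction t <;> simp_all [Tm.val, Tm.subst]

theorem Fml.sat_subst (A : Str) (φ : Fml) : ∀ (σ : ℕ → Tm) (ρ : ℕ → ℕ) (e : ℕ → A.M) (E : ℕ → A.S),
    (φ.subst σ ρ).Sat A e E ↔ φ.Sat A (fun i => (σ i).val A e) fun i => E (ρ i) := by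
  have up (σ : ℕ → Tm) (e : ℕ → A.M) (m : A.M) :
      (fun i => (Tm.upSubst σ i).val A (cons m e)) = cons m fun i => (σ i).val A e := by
    funext i; cases i <;> simp [Tm.upSubst, Tm.val, Tm.lift, Tm.val_subst]
  have upSet (ρ : ℕ → ℕ) (E : ℕ → A.S) (X : A.S) :
      (fun i => cons X E (upRen ρ i)) = cons X fun i => E (ρ i) := by
    funext i; cases i <;> simp [upRen]
  induction φ with
  | pos a | neg a => intros; cases a <;> simp [subst, Atom.subst, Fml.Sat, Atom.Sat, Tm.val_subst]
  | _ => intros; simp_all [subst, Fml.Sat]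

instance (A : Str) : Zero A.M := ⟨A.zero⟩
instance (A : Str) : One A.M := ⟨A.succ A.zero⟩
instance (A : Str) : Add A.M := ⟨A.add⟩
instance (A : Str) : Mul A.M := ⟨A.mul⟩
instance (A : Str) : LE A.M := ⟨A.le⟩
instance (A : Str) : Membership A.M A.S := ⟨fun X x => A.mem x X⟩

section

variable (A : Str) (e : ℕ → A.M) (E : ℕ → A.S)

@[simp] theorem Tm.val_var (i : ℕ) : (Tm.var i).val A e = e i := rfl

@[simp] theorem Tm.val_zero : Tm.zero.val A e = 0 := rfl

@[simp] theorem Tm.val_add (s t : Tm) : (s.add t).val A e = s.val A e + t.val A e := rfl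

@[simp] theorem Tm.val_mul (s t : Tm) : (s.mul t).val A e = s.val A e * t.val A e := rfl

theorem Tm.val_lift (k : ℕ) (t : Tm) : (t.lift k).val A e = t.val A fun i => e (i + k) := by
  simp [lift, val_subst]

@[simp] theorem Tm.val_lift_one (t : Tm) (a : A.M) : (t.lift 1).val A (cons a e) = t.val A e :=
  val_lift A _ 1 t

@[simp] theorem Tm.val_lift_two (t : Tm) (a b : A.M) :
    (t.lift 2).val A (cons a (cons b e)) = t.val A e :=
  val_lift A _ 2 t

@[simp] theorem Tm.val_lift_three (t : Tm) (a b c : A.M) :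
    (t.lift 3).val A (cons a (cons b (cons c e))) = t.val A e :=
  val_lift A _ 3 t

@[simp] theorem Tm.val_lift_four (t : Tm) (a b c d : A.M) :
    (t.lift 4).val A (cons a (cons b (cons c (cons d e)))) = t.val A e :=
  val_lift A _ 4 t

@[simp] theorem Tm.val_lift_six (t : Tm) (a b c d a' b' : A.M) :
    (t.lift 6).val A (cons a (cons b (cons c (cons d (cons a' (cons b' e)))))) = t.val A e :=
  val_lift A _ 6 t

@[simp] theorem cons_two {α : Type} (a : α) (e : ℕ → α) : cons a e 2 = e 1 := rfl

@[simp] theorem cons_three {α : Type} (a : α) (e : ℕ → α) : cons a e 3 = e 2 := rfl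

namespace Fml

variable (φ ψ : Fml)

@[simp] theorem sat_le (s t : Tm) : (le s t).Sat A e E ↔ s.val A e ≤ t.val A e := Iff.rfl

@[simp] theorem sat_mem (t : Tm) (X : ℕ) : (mem t X).Sat A e E ↔ t.val A e ∈ E X := Iff.rfl

@[simp] theorem sat_and : (and φ ψ).Sat A e E ↔ φ.Sat A e E ∧ ψ.Sat A e E := Iff.rfl

@[simp] theorem sat_or : (or φ ψ).Sat A e E ↔ φ.Sat A e E ∨ ψ.Sat A e E := Iff.rfl

@[simp] theorem sat_all : (all φ).Sat A e E ↔ ∀ x, φ.Sat A (cons x e) E := Iff.rfl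

@[simp] theorem sat_ex : (ex φ).Sat A e E ↔ ∃ x, φ.Sat A (cons x e) E := Iff.rfl

attribute [simp] sat_not all₁ all₂ all₃ all₄ ex₁ ex₂ ex₄

@[simp] theorem sat_imp : (imp φ ψ).Sat A e E ↔ (φ.Sat A e E → ψ.Sat A e E) := by
  simp [imp, imp_iff_not_or]

@[simp] theorem sat_iff : (iff φ ψ).Sat A e E ↔ (φ.Sat A e E ↔ ψ.Sat A e E) := by
  simp [iff, iff_iff_implies_and_implies]

end Fml

end

/-! ### Models of `ACA₀` -/

/-- A structure with equality that satisfies the axioms of `ACA₀`. -/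
class ACAModel (A : Str) : Prop where
  eq_iff : ∀ x y, A.eq x y ↔ x = y
  models : A.Models ACA₀
  nonempty : Nonempty A.S

namespace ACAModel

variable {A : Str} [ACAModel A]

theorem sat_robinson {φ : Fml} (h : RobinsonAxiom φ) (e : ℕ → A.M) (E : ℕ → A.S) : φ.Sat A e E :=
  models φ (.inr (.inl h)) e E

@[simp] theorem sat_eq (s t : Tm) (e : ℕ → A.M) (E : ℕ → A.S) :
    (Fml.eq s t).Sat A e E ↔ s.val A e = t.val A e := eq_iff _ _

theorem succ_ne_zero' (x : A.M) : A.succ x ≠ 0 := by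
  obtain ⟨X⟩ := nonempty (A := A)
  exact fun h => sat_robinson (A := A) .q1 (fun _ => x) (fun _ => X) x ((eq_iff _ _).2 h)

theorem succ_injective (x y : A.M) : A.succ x = A.succ y → x = y := by
  obtain ⟨X⟩ := nonempty (A := A)
  simpa [Tm.val] using sat_robinson (A := A) .q2 (fun _ => x) (fun _ => X) x y

theorem add_zero' (x : A.M) : x + 0 = x := by
  obtain ⟨X⟩ := nonempty (A := A)
  exact (sat_eq _ _ _ _).1 (sat_robinson (A := A) .q4 (fun _ => x) (fun _ => X) x)

theorem add_succ' (x y : A.M) : x + A.succ y = A.succ (x + y) := by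
  obtain ⟨X⟩ := nonempty (A := A)
  exact (sat_eq _ _ _ _).1 (sat_robinson (A := A) .q5 (fun _ => x) (fun _ => X) x y)

theorem succ_eq (x : A.M) : A.succ x = x + 1 := by
  rw [show (1 : A.M) = A.succ 0 from rfl, add_succ', add_zero']

@[simp] theorem val_succ (t : Tm) (e : ℕ → A.M) : t.succ.val A e = t.val A e + 1 := succ_eq _

section

variable (x y : A.M)

theorem add_one_ne_zero' : x + 1 ≠ 0 := succ_eq x ▸ succ_ne_zero' x

theorem add_one_injective {x y : A.M} (h : x + 1 = y + 1) : x = y :=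
  succ_injective x y (by rwa [succ_eq, succ_eq])

theorem eq_zero_or_eq_add_one : x = 0 ∨ ∃ y, x = y + 1 := by
  obtain ⟨X⟩ := nonempty (A := A)
  have := sat_robinson (A := A) .q3 (fun _ => x) (fun _ => X) x
  simpa [or_iff_not_imp_left] using this

theorem add_add_one' : x + (y + 1) = x + y + 1 := by
  rw [← succ_eq, ← succ_eq, add_succ']

theorem mul_zero' : x * 0 = 0 := by
  obtain ⟨X⟩ := nonempty (A := A)
  exact (sat_eq _ _ _ _).1 (sat_robinson (A := A) .q6 (fun _ => x) (fun _ => X) x)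

theorem mul_add_one' : x * (y + 1) = x * y + x := by
  obtain ⟨X⟩ := nonempty (A := A)
  rw [← succ_eq]
  exact (sat_eq _ _ _ _).1 (sat_robinson (A := A) .q7 (fun _ => x) (fun _ => X) x y)

theorem le_iff : x ≤ y ↔ ∃ z, z + x = y := by
  obtain ⟨X⟩ := nonempty (A := A)
  simpa using sat_robinson (A := A) .q8 (fun _ => x) (fun _ => X) x y

end

theorem set_induction (X : A.S) (h₀ : 0 ∈ X) (h : ∀ x : A.M, x ∈ X → x + 1 ∈ X) (x : A.M) :
    x ∈ X := by
  have := models (A := A) setInduction (.inr (.inr (.inr rfl))) (fun _ => x) (fun _ => X) X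
  simp only [sat_imp, sat_and, sat_mem, all₁, sat_all, val_succ, Tm.val_zero, Tm.val_var,
    cons_zero] at this
  exact this ⟨h₀, h⟩ x

theorem sat_comprehension {φ : Fml} (h : φ.IsArithmetical) (e : ℕ → A.M) (E : ℕ → A.S) :
    ∃ X : A.S, ∀ x : A.M, x ∈ X ↔ φ.Sat A (cons x e) E := by
  obtain ⟨X, hX⟩ := models (A := A) (comprehension φ) (.inr (.inr (.inl ⟨φ, h, rfl⟩))) e E
  exact ⟨X, fun x => by simpa [shiftSet, sat_subst] using hX x⟩

end ACAModel

/-! ### Arithmetically definable predicates -/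

/-- Functions of assignments that are given by polynomials. -/
class inductive TermFn {A : Str} : ((ℕ → A.M) → A.M) → Prop
  | var (i : ℕ) : TermFn fun e => e i
  | const (m : A.M) : TermFn fun _ => m
  | add {f g : (ℕ → A.M) → A.M} (hf : TermFn f) (hg : TermFn g) : TermFn fun e => f e + g e
  | mul {f g : (ℕ → A.M) → A.M} (hf : TermFn f) (hg : TermFn g) : TermFn fun e => f e * g e

/-- Predicates of assignments that are defined by arithmetical formulas with parameters. -/
class inductive Arith {A : Str} : ((ℕ → A.M) → Prop) → Prop
  | eq {f g : (ℕ → A.M) → A.M} (hf : TermFn f) (hg : TermFn g) : Arith fun e => f e = g e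
  | le {f g : (ℕ → A.M) → A.M} (hf : TermFn f) (hg : TermFn g) : Arith fun e => f e ≤ g e
  | mem {f : (ℕ → A.M) → A.M} (X : A.S) (hf : TermFn f) : Arith fun e => f e ∈ X
  | not {P : (ℕ → A.M) → Prop} (hP : Arith P) : Arith fun e => ¬ P e
  | and {P Q : (ℕ → A.M) → Prop} (hP : Arith P) (hQ : Arith Q) : Arith fun e => P e ∧ Q e
  | or {P Q : (ℕ → A.M) → Prop} (hP : Arith P) (hQ : Arith Q) : Arith fun e => P e ∨ Q e
  | ex {P : (ℕ → A.M) → A.M → Prop} (hP : Arith fun e => P (fun i => e (i + 1)) (e 0)) :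
      Arith fun e => ∃ y, P e y
  | all {P : (ℕ → A.M) → A.M → Prop} (hP : Arith fun e => P (fun i => e (i + 1)) (e 0)) :
      Arith fun e => ∀ y, P e y

section

variable {A : Str}

attribute [instance] TermFn.var TermFn.const

instance {f g : (ℕ → A.M) → A.M} [hf : TermFn f] [hg : TermFn g] : TermFn fun e => f e + g e :=
  hf.add hg

instance {f g : (ℕ → A.M) → A.M} [hf : TermFn f] [hg : TermFn g] : TermFn fun e => f e * g e :=
  hf.mul hg

instance {f g : (ℕ → A.M) → A.M} [hf : TermFn f] [hg : TermFn g] : Arith fun e => f e = g e :=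
  .eq hf hg

instance {f g : (ℕ → A.M) → A.M} [hf : TermFn f] [hg : TermFn g] : Arith fun e => f e ≤ g e :=
  .le hf hg

instance {f : (ℕ → A.M) → A.M} (X : A.S) [hf : TermFn f] : Arith fun e => f e ∈ X :=
  .mem X hf

section

variable {P Q : (ℕ → A.M) → Prop}

instance [hP : Arith P] : Arith fun e => ¬ P e := hP.not

instance [hP : Arith P] [hQ : Arith Q] : Arith fun e => P e ∧ Q e := hP.and hQ

instance [hP : Arith P] [hQ : Arith Q] : Arith fun e => P e ∨ Q e := hP.or hQ

instance Arith.imp [hP : Arith P] [hQ : Arith Q] : Arith fun e => P e → Q e := by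
  simpa only [imp_iff_not_or] using hP.not.or hQ

instance Arith.iff [hP : Arith P] [hQ : Arith Q] : Arith fun e => P e ↔ Q e := by
  have := (Arith.imp (P := P) (Q := Q)).and (Arith.imp (P := Q) (Q := P))
  simpa only [iff_iff_implies_and_implies] using this

end

instance {P : (ℕ → A.M) → A.M → Prop} [hP : Arith fun e => P (fun i => e (i + 1)) (e 0)] :
    Arith fun e => ∃ y, P e y := .ex hP

instance {P : (ℕ → A.M) → A.M → Prop} [hP : Arith fun e => P (fun i => e (i + 1)) (e 0)] :
    Arith fun e => ∀ y, P e y := .all hP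

theorem TermFn.comp {f : (ℕ → A.M) → A.M} (hf : TermFn f) {G : (ℕ → A.M) → ℕ → A.M}
    (hG : ∀ i, TermFn fun e => G e i) : TermFn fun e => f (G e) := by
  induction hf with
  | var i => exact hG i
  | const m => exact .const m
  | add _ _ ih₁ ih₂ => exact ih₁.add ih₂
  | mul _ _ ih₁ ih₂ => exact ih₁.mul ih₂

/-- The substitution of polynomials in a definable predicate. -/
theorem Arith.comp {P : (ℕ → A.M) → Prop} (hP : Arith P) : ∀ {G : (ℕ → A.M) → ℕ → A.M},
    (∀ i, TermFn fun e => G e i) → Arith fun e => P (G e) := by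
  have up {G : (ℕ → A.M) → ℕ → A.M} (hG : ∀ i, TermFn fun e => G e i) :
      ∀ i, TermFn fun e => cons (e 0) (G fun i => e (i + 1)) i
    | 0 => .var 0
    | i + 1 => (hG i).comp fun j => .var (j + 1)
  induction hP with
  | eq hf hg => exact fun hG => .eq (hf.comp hG) (hg.comp hG)
  | le hf hg => exact fun hG => .le (hf.comp hG) (hg.comp hG)
  | mem X hf => exact fun hG => .mem X (hf.comp hG)
  | not _ ih => exact fun hG => (ih hG).not
  | and _ _ ih₁ ih₂ => exact fun hG => (ih₁ hG).and (ih₂ hG)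
  | or _ _ ih₁ ih₂ => exact fun hG => (ih₁ hG).or (ih₂ hG)
  | @ex P _ ih => exact fun {G} hG => .ex (P := fun e => P (G e)) (ih (up hG))
  | @all P _ ih => exact fun {G} hG => .all (P := fun e => P (G e)) (ih (up hG))

theorem Arith.comp₁ {Q : A.M → Prop} (h : Arith fun e => Q (e 0)) {f : (ℕ → A.M) → A.M}
    (hf : TermFn f) : Arith fun e => Q (f e) :=
  h.comp (G := fun e _ => f e) fun _ => hf

theorem Arith.comp₂ {R : A.M → A.M → Prop} (h : Arith fun e => R (e 0) (e 1))
    {f g : (ℕ → A.M) → A.M} (hf : TermFn f) (hg : TermFn g) : Arith fun e => R (f e) (g e) :=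
  h.comp (G := fun e => cons (f e) fun _ => g e) fun i => by cases i <;> assumption

theorem Arith.comp₃ {R : A.M → A.M → A.M → Prop} (h : Arith fun e => R (e 0) (e 1) (e 2))
    {f g k : (ℕ → A.M) → A.M} (hf : TermFn f) (hg : TermFn g) (hk : TermFn k) :
    Arith fun e => R (f e) (g e) (k e) :=
  h.comp (G := fun e => cons (f e) (cons (g e) fun _ => k e)) fun i => by
    rcases i with _ | _ | i <;> assumption

variable [ACAModel A]

theorem TermFn.val (t : Tm) : TermFn fun e => t.val A e := by
  induction t with
  | var i => exact .var i
  | zero => exact .const 0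
  | succ t ih => simpa only [Tm.val, ACAModel.succ_eq] using ih.add (.const 1)
  | add s t ihs iht => exact ihs.add iht
  | mul s t ihs iht => exact ihs.mul iht

theorem Arith.sat {φ : Fml} (h : φ.IsArithmetical) (E : ℕ → A.S) : Arith fun e => φ.Sat A e E := by
  have atom (a : Atom) : Arith fun e => a.Sat A e E := by
    cases a with
    | eq s t => simpa only [Atom.Sat, ACAModel.eq_iff] using Arith.eq (.val s) (.val t)
    | le s t => exact .le (.val s) (.val t)
    | mem t X => exact .mem (E X) (.val t)
  induction φ with
  | pos a => exact atom a
  | neg a => exact (atom a).not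
  | and φ ψ ih₁ ih₂ => exact (ih₁ h.1).and (ih₂ h.2)
  | or φ ψ ih₁ ih₂ => exact (ih₁ h.1).or (ih₂ h.2)
  | all φ ih =>
    exact .all (P := fun e y => φ.Sat A (cons y e) E) (by simpa only [cons_eta] using ih h)
  | ex φ ih =>
    exact .ex (P := fun e y => φ.Sat A (cons y e) E) (by simpa only [cons_eta] using ih h)
  | allSet => exact h.elim
  | exSet => exact h.elim

omit [ACAModel A] in
theorem TermFn.exists_tm {f : (ℕ → A.M) → A.M} (hf : TermFn f) : ∃ F : Finset A.M,
    ∀ (p : ℕ → ℕ) (q : A.M → ℕ), ∃ t : Tm, ∀ (e e' : ℕ → A.M), (∀ m ∈ F, e' (q m) = m) →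
      (∀ i, e' (p i) = e i) → t.val A e' = f e := by
  classical
  induction hf with
  | var i => exact ⟨∅, fun p q => ⟨.var (p i), fun e e' _ h => h i⟩⟩
  | const m => exact ⟨{m}, fun p q => ⟨.var (q m), fun e e' h _ => h m (by simp)⟩⟩
  | add _ _ ih₁ ih₂ =>
    obtain ⟨F₁, h₁⟩ := ih₁
    obtain ⟨F₂, h₂⟩ := ih₂
    refine ⟨F₁ ∪ F₂, fun p q => ?_⟩
    obtain ⟨t₁, h₁⟩ := h₁ p q
    obtain ⟨t₂, h₂⟩ := h₂ p q
    exact ⟨.add t₁ t₂, fun e e' h h' => congrArg₂ A.add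
      (h₁ e e' (fun m hm => h m (by simp [hm])) h')
      (h₂ e e' (fun m hm => h m (by simp [hm])) h')⟩
  | mul _ _ ih₁ ih₂ =>
    obtain ⟨F₁, h₁⟩ := ih₁
    obtain ⟨F₂, h₂⟩ := ih₂
    refine ⟨F₁ ∪ F₂, fun p q => ?_⟩
    obtain ⟨t₁, h₁⟩ := h₁ p q
    obtain ⟨t₂, h₂⟩ := h₂ p q
    exact ⟨.mul t₁ t₂, fun e e' h h' => congrArg₂ A.mul
      (h₁ e e' (fun m hm => h m (by simp [hm])) h')
      (h₂ e e' (fun m hm => h m (by simp [hm])) h')⟩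

/-- A definable predicate is defined by a formula, for any sufficiently rich choice of variables
for the parameters. -/
theorem Arith.exists_fml {P : (ℕ → A.M) → Prop} (hP : Arith P) :
    ∃ (F : Finset A.M) (G : Finset A.S), ∀ (p : ℕ → ℕ) (q : A.M → ℕ) (r : A.S → ℕ),
      ∃ φ : Fml, φ.IsArithmetical ∧ ∀ (e e' : ℕ → A.M) (E : ℕ → A.S), (∀ m ∈ F, e' (q m) = m) →
        (∀ X ∈ G, E (r X) = X) → (∀ i, e' (p i) = e i) → (φ.Sat A e' E ↔ P e) := by
  classical
  induction hP with
  | eq hf hg =>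
    obtain ⟨F₁, h₁⟩ := hf.exists_tm
    obtain ⟨F₂, h₂⟩ := hg.exists_tm
    refine ⟨F₁ ∪ F₂, ∅, fun p q r => ?_⟩
    obtain ⟨t₁, h₁⟩ := h₁ p q
    obtain ⟨t₂, h₂⟩ := h₂ p q
    refine ⟨Fml.eq t₁ t₂, trivial, fun e e' E h _ h' => ?_⟩
    simp only [ACAModel.sat_eq, h₁ e e' (fun m hm => h m (by simp [hm])) h',
      h₂ e e' (fun m hm => h m (by simp [hm])) h']
  | le hf hg =>
    obtain ⟨F₁, h₁⟩ := hf.exists_tm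
    obtain ⟨F₂, h₂⟩ := hg.exists_tm
    refine ⟨F₁ ∪ F₂, ∅, fun p q r => ?_⟩
    obtain ⟨t₁, h₁⟩ := h₁ p q
    obtain ⟨t₂, h₂⟩ := h₂ p q
    refine ⟨Fml.le t₁ t₂, trivial, fun e e' E h _ h' => ?_⟩
    simp only [sat_le, h₁ e e' (fun m hm => h m (by simp [hm])) h',
      h₂ e e' (fun m hm => h m (by simp [hm])) h']
  | mem X hf =>
    obtain ⟨F, h⟩ := hf.exists_tm
    refine ⟨F, {X}, fun p q r => ?_⟩
    obtain ⟨t, ht⟩ := h p q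
    refine ⟨Fml.mem t (r X), trivial, fun e e' E h k h' => ?_⟩
    simp only [sat_mem, ht e e' h h', k X (Finset.mem_singleton_self X)]
  | not _ ih =>
    obtain ⟨F, G, h⟩ := ih
    refine ⟨F, G, fun p q r => ?_⟩
    obtain ⟨φ, hφ, h⟩ := h p q r
    have arith : ∀ {φ : Fml}, φ.IsArithmetical → φ.not.IsArithmetical := by
      intro φ hφ
      induction φ <;> simp_all [IsArithmetical, Fml.not]
    exact ⟨φ.not, arith hφ, fun e e' E h₁ h₂ h₃ => by rw [sat_not, h e e' E h₁ h₂ h₃]⟩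
  | and _ _ ih₁ ih₂ =>
    obtain ⟨F₁, G₁, h₁⟩ := ih₁
    obtain ⟨F₂, G₂, h₂⟩ := ih₂
    refine ⟨F₁ ∪ F₂, G₁ ∪ G₂, fun p q r => ?_⟩
    obtain ⟨φ, hφ, h₁⟩ := h₁ p q r
    obtain ⟨ψ, hψ, h₂⟩ := h₂ p q r
    refine ⟨.and φ ψ, ⟨hφ, hψ⟩, fun e e' E h k h' => ?_⟩
    rw [Fml.Sat, h₁ e e' E (fun m hm => h m (by simp [hm])) (fun m hm => k m (by simp [hm])) h',
      h₂ e e' E (fun m hm => h m (by simp [hm])) (fun m hm => k m (by simp [hm])) h']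
  | or _ _ ih₁ ih₂ =>
    obtain ⟨F₁, G₁, h₁⟩ := ih₁
    obtain ⟨F₂, G₂, h₂⟩ := ih₂
    refine ⟨F₁ ∪ F₂, G₁ ∪ G₂, fun p q r => ?_⟩
    obtain ⟨φ, hφ, h₁⟩ := h₁ p q r
    obtain ⟨ψ, hψ, h₂⟩ := h₂ p q r
    refine ⟨.or φ ψ, ⟨hφ, hψ⟩, fun e e' E h k h' => ?_⟩
    rw [Fml.Sat, h₁ e e' E (fun m hm => h m (by simp [hm])) (fun m hm => k m (by simp [hm])) h',
      h₂ e e' E (fun m hm => h m (by simp [hm])) (fun m hm => k m (by simp [hm])) h']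
  | ex _ ih =>
    obtain ⟨F, G, h⟩ := ih
    refine ⟨F, G, fun p q r => ?_⟩
    obtain ⟨φ, hφ, h⟩ := h (cons 0 fun i => p i + 1) (fun m => q m + 1) r
    refine ⟨.ex φ, hφ, fun e e' E h₁ h₂ h₃ => exists_congr fun m => ?_⟩
    exact h (cons m e) (cons m e') E h₁ h₂ fun i => by cases i <;> simp [h₃]
  | all _ ih =>
    obtain ⟨F, G, h⟩ := ih
    refine ⟨F, G, fun p q r => ?_⟩
    obtain ⟨φ, hφ, h⟩ := h (cons 0 fun i => p i + 1) (fun m => q m + 1) r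
    refine ⟨.all φ, hφ, fun e e' E h₁ h₂ h₃ => forall_congr' fun m => ?_⟩
    exact h (cons m e) (cons m e') E h₁ h₂ fun i => by cases i <;> simp [h₃]

theorem exists_enumeration {α : Type} [Nonempty α] (F : Finset α) :
    ∃ (c : ℕ → α) (q : α → ℕ), ∀ a ∈ F, c (q a) = a := by
  classical
  obtain ⟨a₀⟩ := ‹Nonempty α›
  refine ⟨fun i => F.toList.getD i a₀, fun a => F.toList.idxOf a, fun a ha => ?_⟩
  have : a ∈ F.toList := by simpa using ha
  beta_reduce
  rw [List.getD_eq_getElem _ _ (List.idxOf_lt_length_iff.2 this), List.getElem_idxOf]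

namespace ACAModel

theorem exists_set {Q : A.M → Prop} (hQ : Arith fun e => Q (e 0)) :
    ∃ X : A.S, ∀ x, x ∈ X ↔ Q x := by
  have : Nonempty A.S := nonempty
  have : Nonempty A.M := ⟨0⟩
  obtain ⟨F, G, h⟩ := hQ.exists_fml
  obtain ⟨c, q, hq⟩ := exists_enumeration F
  obtain ⟨E, r, hr⟩ := exists_enumeration G
  obtain ⟨φ, hφ, h⟩ := h (fun _ => 0) (fun m => q m + 1) r
  obtain ⟨X, hX⟩ := sat_comprehension hφ c E
  exact ⟨X, fun x => (hX x).trans (h (fun _ => x) (cons x c) E hq hr fun _ => rfl)⟩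

/-- Induction for arithmetical predicates. -/
theorem induction {Q : A.M → Prop} [hQ : Arith fun e => Q (e 0)] (h₀ : Q 0)
    (h : ∀ x, Q x → Q (x + 1)) (x : A.M) : Q x := by
  obtain ⟨X, hX⟩ := exists_set hQ
  exact (hX x).1 (set_induction X ((hX 0).2 h₀) (fun x hx => (hX _).2 (h x ((hX x).1 hx))) x)

/-! ### Models are ordered semirings -/

theorem add_assoc' (x y z : A.M) : x + y + z = x + (y + z) := by
  refine induction (Q := fun z => x + y + z = x + (y + z)) ?_ (fun z ih => ?_) z
  · simp only [add_zero']
  · simp only [add_add_one', ih]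

theorem zero_add' (x : A.M) : 0 + x = x := by
  refine induction (Q := fun x => 0 + x = x) (add_zero' 0) (fun x ih => ?_) x
  rw [add_add_one', ih]

theorem add_one_add' (x y : A.M) : x + 1 + y = x + y + 1 := by
  refine induction (Q := fun y => x + 1 + y = x + y + 1) ?_ (fun y ih => ?_) y
  · simp only [add_zero']
  · simp only [add_add_one', ih]

theorem add_comm' (x y : A.M) : x + y = y + x := by
  refine induction (Q := fun y => x + y = y + x) ?_ (fun y ih => ?_) y
  · rw [add_zero', zero_add']
  · rw [add_add_one', add_one_add', ih]

theorem zero_mul' (x : A.M) : 0 * x = 0 := by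
  refine induction (Q := fun x => 0 * x = 0) (mul_zero' 0) (fun x ih => ?_) x
  rw [mul_add_one', ih, add_zero']

theorem add_one_mul' (x y : A.M) : (x + 1) * y = x * y + y := by
  refine induction (Q := fun y => (x + 1) * y = x * y + y) ?_ (fun y ih => ?_) y
  · simp only [mul_zero', add_zero']
  · rw [mul_add_one', ih, mul_add_one', add_add_one', add_add_one', add_assoc' _ y x,
      add_comm' y x, ← add_assoc']

theorem mul_comm' (x y : A.M) : x * y = y * x := by
  refine induction (Q := fun y => x * y = y * x) ?_ (fun y ih => ?_) y
  · rw [mul_zero', zero_mul']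
  · rw [mul_add_one', add_one_mul', ih]

theorem mul_add' (x y z : A.M) : x * (y + z) = x * y + x * z := by
  refine induction (Q := fun z => x * (y + z) = x * y + x * z) ?_ (fun z ih => ?_) z
  · simp only [mul_zero', add_zero']
  · rw [add_add_one', mul_add_one', ih, mul_add_one', add_assoc']

theorem mul_assoc' (x y z : A.M) : x * y * z = x * (y * z) := by
  refine induction (Q := fun z => x * y * z = x * (y * z)) ?_ (fun z ih => ?_) z
  · simp only [mul_zero']
  · rw [mul_add_one', mul_add_one', ih, mul_add']

theorem one_mul' (x : A.M) : 1 * x = x := by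
  rw [← zero_add' 1, add_one_mul', zero_mul', zero_add']

noncomputable instance : CommSemiring A.M where
  add_assoc := add_assoc'
  zero_add := zero_add'
  add_zero := add_zero'
  add_comm := add_comm'
  mul_assoc := mul_assoc'
  mul_comm := mul_comm'
  one_mul := one_mul'
  mul_one x := by rw [mul_comm', one_mul']
  left_distrib := mul_add'
  right_distrib x y z := by rw [mul_comm', mul_add', mul_comm' z, mul_comm' z]
  zero_mul := zero_mul'
  mul_zero := mul_zero'
  nsmul := nsmulRec
  npow := npowRec

instance : IsCancelAdd A.M := by
  have : IsRightCancelAdd A.M := ⟨fun x y z h => by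
    refine induction (Q := fun x => y + x = z + x → y = z) ?_ (fun x ih h => ?_) x h
    · simp
    · rw [← add_assoc, ← add_assoc] at h
      exact ih (add_one_injective h)⟩
  exact AddCommMagma.IsRightCancelAdd.toIsCancelAdd A.M

theorem eq_zero_of_add_eq_zero {x y : A.M} (h : x + y = 0) : y = 0 := by
  rcases eq_zero_or_eq_add_one y with rfl | ⟨z, rfl⟩
  · rfl
  · exact (add_one_ne_zero' _ ((add_assoc x z 1).trans h)).elim

theorem le_total' (x y : A.M) : x ≤ y ∨ y ≤ x := by
  refine induction (Q := fun x => x ≤ y ∨ y ≤ x) ?_ (fun x ih => ?_) x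
  · exact .inl ((le_iff _ _).2 ⟨y, add_zero y⟩)
  · rw [le_iff, le_iff] at ih
    rw [le_iff, le_iff]
    rcases ih with ⟨z, rfl⟩ | ⟨z, rfl⟩
    · rcases eq_zero_or_eq_add_one z with rfl | ⟨z, rfl⟩
      · exact .inr ⟨1, by ring⟩
      · exact .inl ⟨z, by ring⟩
    · exact .inr ⟨z + 1, by ring⟩

noncomputable instance : LinearOrder A.M where
  le_refl x := (le_iff _ _).2 ⟨0, zero_add x⟩
  le_trans x y z h h' := by
    rw [le_iff] at *
    obtain ⟨a, rfl⟩ := h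
    obtain ⟨b, rfl⟩ := h'
    exact ⟨b + a, add_assoc _ _ _⟩
  le_antisymm x y h h' := by
    rw [le_iff] at *
    obtain ⟨a, rfl⟩ := h
    obtain ⟨b, h⟩ := h'
    rw [← add_assoc] at h
    have : b + a = 0 := add_right_cancel (b := x) (by rw [h, zero_add])
    rw [eq_zero_of_add_eq_zero this, zero_add]
  le_total := le_total'
  toDecidableLE := Classical.decRel _

instance : CanonicallyOrderedAdd A.M where
  exists_add_of_le {x y} h := by
    obtain ⟨z, rfl⟩ := (le_iff x y).1 h
    exact ⟨z, add_comm _ _⟩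
  le_add_self x y := (le_iff x _).2 ⟨y, rfl⟩
  le_self_add x y := (le_iff x _).2 ⟨y, add_comm _ _⟩

theorem lt_add_one_iff {x y : A.M} : x < y + 1 ↔ x ≤ y := by
  constructor
  · intro h
    obtain ⟨z, hz⟩ := exists_add_of_le h.le
    rcases eq_zero_or_eq_add_one z with rfl | ⟨z, rfl⟩
    · simp [hz] at h
    · rw [← add_assoc] at hz
      exact add_one_injective hz ▸ le_self_add
  · intro h
    obtain ⟨z, rfl⟩ := exists_add_of_le h
    refine lt_of_le_of_ne (le_self_add.trans le_self_add) fun h => ?_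
    rw [add_assoc, left_eq_add] at h
    exact add_one_ne_zero' _ h

theorem mul_lt_mul_of_pos_left' {x y z : A.M} (hx : 0 < x) (h : y < z) : x * y < x * z := by
  obtain ⟨w, rfl⟩ := exists_add_of_le h.le
  rcases eq_zero_or_eq_add_one w with rfl | ⟨w, rfl⟩
  · simp at h
  rcases eq_zero_or_eq_add_one x with rfl | ⟨x, rfl⟩
  · exact (lt_irrefl _ hx).elim
  refine (lt_add_one_iff.2 (le_self_add (b := (x + 1) * w + x))).trans_eq ?_
  ring

instance : IsStrictOrderedRing A.M where
  add_le_add_left x y h z := by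
    obtain ⟨w, rfl⟩ := exists_add_of_le h
    rw [add_right_comm]
    exact le_self_add
  le_of_add_le_add_left x y z h := by
    obtain ⟨w, h⟩ := exists_add_of_le h
    rw [add_assoc] at h
    exact add_left_cancel h ▸ le_self_add
  zero_le_one := (le_iff _ _).2 ⟨1, add_zero _⟩
  exists_pair_ne := ⟨0, 1, fun h => add_one_ne_zero' (0 : A.M) (by rw [zero_add, h])⟩
  mul_lt_mul_of_pos_left x hx y z h := mul_lt_mul_of_pos_left' hx h
  mul_lt_mul_of_pos_right x hx y z h := by
    simpa only [mul_comm _ x] using mul_lt_mul_of_pos_left' hx h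

/-- Strong induction for arithmetical predicates. -/
theorem strong_induction {Q : A.M → Prop} [hQ : Arith fun e => Q (e 0)]
    (h : ∀ x, (∀ y < x, Q y) → Q x) (x : A.M) : Q x := by
  have : Arith fun e : ℕ → A.M => Q (e 0) := hQ
  have : Arith fun e => ∀ y ≤ e 0, Q y := by
    have := hQ.comp₁ (f := fun e => e 0) (.var 0)
    infer_instance
  refine induction (Q := fun x => ∀ y ≤ x, Q y) (fun y hy => ?_) (fun x ih y hy => ?_) x x le_rfl
  · exact h y fun z hz => (not_lt_zero (hz.trans_le hy)).elim
  · exact h y fun z hz => ih z (lt_add_one_iff.1 (hz.trans_le hy))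

end ACAModel

end

namespace ACAModel

variable {A : Str} [ACAModel A]

/-! ### Cantor pairing in a model -/

theorem lt_iff_add_one_le {x y : A.M} : x < y ↔ x + 1 ≤ y := by
  rw [← lt_add_one_iff, add_lt_add_iff_right]

theorem exists_add_self (s : A.M) : ∃ t, t + t = s * (s + 1) := by
  refine induction (Q := fun s => ∃ t, t + t = s * (s + 1)) ⟨0, by ring⟩ ?_ s
  rintro s ⟨t, ht⟩
  refine ⟨t + s + 1, ?_⟩
  calc t + s + 1 + (t + s + 1) = (t + t) + (s + s + 2) := by ring
    _ = (s + 1) * (s + 1 + 1) := by rw [ht]; ring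

theorem exists_pair (x y : A.M) : ∃ p, p + p = (x + y) * (x + y + 1) + (y + y) := by
  obtain ⟨t, ht⟩ := exists_add_self (x + y)
  exact ⟨t + y, by rw [← ht]; ring⟩

/-- Cantor pairing. -/
noncomputable def pair (x y : A.M) : A.M := (exists_pair x y).choose

theorem pair_add_self (x y : A.M) : pair x y + pair x y = (x + y) * (x + y + 1) + (y + y) :=
  (exists_pair x y).choose_spec

theorem eq_pair_iff {p x y : A.M} :
    p = pair x y ↔ p + p = (x + y) * (x + y + 1) + (y + y) := by
  rw [← pair_add_self]
  constructor
  · rintro rfl; rfl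
  · intro h; grind

theorem pair_lt_of_add_lt {x y x' y' : A.M} (h : x + y < x' + y') : pair x y < pair x' y' := by
  have h₁ := pair_add_self x y
  have h₂ := pair_add_self x' y'
  obtain ⟨d, hd⟩ := exists_add_of_le (lt_iff_add_one_le.1 h)
  have h₃ : (x' + y') * (x' + y' + 1) =
      (x + y) * (x + y + 1) + (x + x + y + y + 1 + 1) + (d * (x + y + x + y + d + 3)) := by
    rw [hd]; ring
  by_contra hle
  obtain ⟨c, hc⟩ := exists_add_of_le (not_lt.1 hle)
  have : (x + y) * (x + y + 1) + (y + y) + (x + x + 1 + d * (x + y + x + y + d + 3) + (y' + y') +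
      (c + c) + 1) = (x + y) * (x + y + 1) + (y + y) + 0 := by
    rw [add_zero]
    refine Eq.trans ?_ h₁
    refine Eq.trans ?_ (congrArg₂ (· + ·) hc hc).symm
    rw [add_add_add_comm (pair x' y'), h₂, h₃]
    ring
  exact add_one_ne_zero' _ (add_left_cancel this)

theorem pair_lt_pair_right (x : A.M) {y y' : A.M} (h : y < y') : pair x y < pair x y' :=
  pair_lt_of_add_lt (by grind)

theorem pair_lt_pair {x y x' y' : A.M} (hx : x < x') (hy : y < y') : pair x y < pair x' y' :=
  pair_lt_of_add_lt (by grind)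

theorem pair_inj {x y x' y' : A.M} : pair x y = pair x' y' ↔ x = x' ∧ y = y' := by
  refine ⟨fun h => ?_, by rintro ⟨rfl, rfl⟩; rfl⟩
  rcases lt_trichotomy (x + y) (x' + y') with hs | hs | hs
  · exact ((pair_lt_of_add_lt hs).ne h).elim
  · have h₁ := pair_add_self x y
    have h₂ := pair_add_self x' y'
    rw [h, h₂, hs] at h₁
    have : y + y = y' + y' := (add_left_cancel h₁).symm
    grind
  · exact ((pair_lt_of_add_lt hs).ne h.symm).elim

theorem exists_eq_pair (p : A.M) : ∃ x y, p = pair x y := by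
  simp only [eq_pair_iff]
  refine induction (Q := fun p => ∃ x y, p + p = (x + y) * (x + y + 1) + (y + y))
    ⟨0, 0, by ring⟩ ?_ p
  rintro p ⟨x, y, h⟩
  rcases eq_zero_or_eq_add_one x with rfl | ⟨x, rfl⟩
  · refine ⟨y + 1, 0, ?_⟩
    calc p + 1 + (p + 1) = p + p + 2 := by ring
      _ = _ := by rw [h]; ring
  · refine ⟨x, y + 1, ?_⟩
    calc p + 1 + (p + 1) = p + p + 2 := by ring
      _ = _ := by rw [h]; ring

theorem right_le_pair (x y : A.M) : y ≤ pair x y := by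
  have h := pair_add_self x y
  have h' : 0 ≤ (x + y) * (x + y + 1) := zero_le
  grind

theorem left_le_pair (x y : A.M) : x ≤ pair x y := by
  rcases eq_zero_or_eq_add_one x with rfl | ⟨x, rfl⟩
  · exact zero_le
  · have h := pair_add_self (x + 1) y
    have h' : (x + 1 + y) * (x + 1 + y + 1) = (x + 1) + (x + 1) + (x * (x + 1) + y * (x + 1) +
      (x + 1) * y + y * y + y) := by ring
    have h'' : 0 ≤ x * (x + 1) + y * (x + 1) + (x + 1) * y + y * y + y := zero_le
    have : 0 ≤ y := zero_le
    grind

/-- The code of a tree with given immediate subtrees. -/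
noncomputable def node (x y : A.M) : A.M := pair x y + 1

theorem node_inj {x y x' y' : A.M} : node x y = node x' y' ↔ x = x' ∧ y = y' := by
  rw [node, node, add_left_inj, pair_inj]

theorem node_ne_zero (x y : A.M) : node x y ≠ 0 := add_one_ne_zero' _

theorem left_lt_node (x y : A.M) : x < node x y := lt_add_one_iff.2 (left_le_pair x y)

theorem right_lt_node (x y : A.M) : y < node x y := lt_add_one_iff.2 (right_le_pair x y)

theorem eq_zero_or_eq_node (x : A.M) : x = 0 ∨ ∃ y z, x = node y z := by
  rcases eq_zero_or_eq_add_one x with rfl | ⟨x, rfl⟩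
  · exact .inl rfl
  · obtain ⟨y, z, rfl⟩ := exists_eq_pair x
    exact .inr ⟨y, z, rfl⟩

instance {f g k : (ℕ → A.M) → A.M} [TermFn f] [TermFn g] [TermFn k] :
    Arith fun e => f e = pair (g e) (k e) := by
  simp only [eq_pair_iff]; infer_instance

instance {f g k : (ℕ → A.M) → A.M} [hf : TermFn f] [hg : TermFn g] [hk : TermFn k] :
    Arith fun e => f e = node (g e) (k e) := by
  refine Arith.comp₃ (R := fun n x y => n = node x y) ?_ hf hg hk
  have key : ∀ n x y : A.M, n = node x y ↔ ∃ p, p = pair x y ∧ n = p + 1 := by simp [node]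
  simp only [key]
  infer_instance

theorem node_induction {Q : A.M → Prop} [Arith fun e => Q (e 0)] (h₀ : Q 0)
    (h : ∀ x y, Q x → Q y → Q (node x y)) (x : A.M) : Q x := by
  refine strong_induction (Q := Q) (fun x ih => ?_) x
  rcases eq_zero_or_eq_node x with rfl | ⟨y, z, rfl⟩
  · exact h₀
  · exact h y z (ih y (left_lt_node y z)) (ih z (right_lt_node y z))

/-! ### Codes for finite sets -/

/-- Membership of `n` in the finite set coded by `u` and `v`. -/
def InCode (n u v : A.M) : Prop := ∃ q, u = q * ((n + 1) * v + 1)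

theorem inCode_iff_dvd {n u v : A.M} : InCode n u v ↔ (n + 1) * v + 1 ∣ u :=
  exists_congr fun q => by rw [mul_comm]

instance {f g k : (ℕ → A.M) → A.M} [hf : TermFn f] [hg : TermFn g] [hk : TermFn k] :
    Arith fun e => InCode (f e) (g e) (k e) :=
  Arith.comp₃ (R := fun n u v => InCode n u v) (by unfold InCode; infer_instance) hf hg hk

theorem dvd_of_dvd_add {p x y : A.M} (hx : p ∣ x) (h : p ∣ x + y) : p ∣ y := by
  obtain ⟨a, rfl⟩ := hx
  obtain ⟨b, hb⟩ := h
  rcases le_total a b with hab | hab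
  · obtain ⟨c, rfl⟩ := exists_add_of_le hab
    rw [mul_add] at hb
    exact ⟨c, add_left_cancel hb⟩
  · obtain ⟨c, rfl⟩ := exists_add_of_le hab
    have : p * c + y = 0 := by
      refine add_left_cancel (a := p * b) ?_
      rw [add_zero, ← add_assoc, ← mul_add, hb]
    exact eq_zero_of_add_eq_zero this ▸ dvd_zero p

theorem exists_common_multiple (b : A.M) : ∃ v, v ≠ 0 ∧ ∀ i, i ≠ 0 → i ≤ b → ∃ c, v = i * c := by
  refine induction (Q := fun b => ∃ v, v ≠ 0 ∧ ∀ i, i ≠ 0 → i ≤ b → ∃ c, v = i * c) ?_ ?_ b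
  · exact ⟨1, one_ne_zero, fun i hi h => (hi (le_antisymm h zero_le)).elim⟩
  · rintro b ⟨v, hv, h⟩
    refine ⟨v * (b + 1), mul_ne_zero hv (add_one_ne_zero' b), fun i hi hib => ?_⟩
    rcases hib.lt_or_eq with hib | rfl
    · obtain ⟨c, rfl⟩ := h i hi (lt_add_one_iff.1 hib)
      exact ⟨c * (b + 1), mul_assoc _ _ _⟩
    · exact ⟨v, mul_comm _ _⟩

theorem dvd_of_dvd_mul_diff {n d v w : A.M} (hd : d ∣ v)
    (h : (n + 1) * v + 1 ∣ w * d * v) : (n + 1) * v + 1 ∣ w := by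
  have h₁ : (n + 1) * v + 1 ∣ w * d := by
    refine dvd_of_dvd_add (h.mul_left (n + 1)) ⟨w * d, ?_⟩
    ring
  obtain ⟨c, hc⟩ := hd
  have h₂ : (n + 1) * v + 1 ∣ w * v := by
    rw [show w * v = w * d * c by rw [hc]; ring]
    exact h₁.mul_right c
  exact dvd_of_dvd_add (h₂.mul_left (n + 1)) ⟨w, by ring⟩

/-- The moduli `1 + (n + 1) * v` for `n ≤ b` are pairwise coprime. -/
theorem dvd_of_dvd_mul_modulus {b n m v w : A.M} (hv : ∀ i, i ≠ 0 → i ≤ b → ∃ c, v = i * c)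
    (hn : n ≤ b) (hm : m ≤ b) (hnm : n ≠ m) (h : (n + 1) * v + 1 ∣ w * ((m + 1) * v + 1)) :
    (n + 1) * v + 1 ∣ w := by
  rcases le_total n m with hle | hle
  · obtain ⟨d, rfl⟩ := exists_add_of_le hle
    refine dvd_of_dvd_mul_diff (d := d) (hv d ?_ (le_add_self.trans hm)) ?_
    · rintro rfl; simp at hnm
    · refine dvd_of_dvd_add (x := w * ((n + 1) * v + 1)) ⟨w, mul_comm _ _⟩ ?_
      convert h using 1
      ring
  · obtain ⟨d, rfl⟩ := exists_add_of_le hle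
    refine dvd_of_dvd_mul_diff (d := d) (hv d ?_ (le_add_self.trans hn)) ?_
    · rintro rfl; simp at hnm
    · refine dvd_of_dvd_add h ⟨w, ?_⟩
      ring

/-- Every set has a code for its initial segments. -/
theorem exists_code (X : A.S) (b : A.M) : ∃ u v : A.M, ∀ n ≤ b, (InCode n u v ↔ n ∈ X) := by
  obtain ⟨v, hv₀, hv⟩ := exists_common_multiple b
  suffices H : ∀ k, ∃ u, ∀ n ≤ b, (InCode n u v ↔ n ∈ X ∧ n < k) by
    obtain ⟨u, hu⟩ := H (b + 1)
    exact ⟨u, v, fun n hn => (hu n hn).trans (and_iff_left (lt_add_one_iff.2 hn))⟩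
  intro k
  refine induction (Q := fun k => ∃ u, ∀ n ≤ b, (InCode n u v ↔ n ∈ X ∧ n < k)) ?_ ?_ k
  · refine ⟨1, fun n _ => ⟨fun h => ?_, fun h => (not_lt_zero h.2).elim⟩⟩
    obtain ⟨c, hc⟩ := inCode_iff_dvd.1 h
    rcases eq_zero_or_eq_add_one c with rfl | ⟨c, rfl⟩
    · simp at hc
    rcases eq_zero_or_eq_add_one v with rfl | ⟨v, rfl⟩
    · exact (hv₀ rfl).elim
    have : (1 : A.M) + (((n + 1) * (v + 1) + 1) * c + n * v + n + v + 1) = 1 + 0 := by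
      rw [add_zero]
      refine Eq.trans ?_ hc.symm
      ring
    exact (add_one_ne_zero' _ (add_left_cancel this)).elim
  · rintro k ⟨u, hu⟩
    by_cases hk : k ∈ X ∧ k ≤ b
    · refine ⟨u * ((k + 1) * v + 1), fun n hn => ?_⟩
      by_cases hnk : n = k
      · subst hnk
        exact iff_of_true ⟨u, rfl⟩ ⟨hk.1, lt_add_one_iff.2 le_rfl⟩
      · rw [lt_add_one_iff, le_iff_lt_or_eq, or_iff_left hnk, ← hu n hn, inCode_iff_dvd,
          inCode_iff_dvd]
        exact ⟨dvd_of_dvd_mul_modulus hv hn hk.2 hnk, fun h => h.mul_right _⟩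
    · refine ⟨u, fun n hn => (hu n hn).trans (and_congr_right fun hX => ?_)⟩
      rw [lt_add_one_iff, le_iff_lt_or_eq, or_iff_left]
      rintro rfl
      exact hk ⟨hX, hn⟩

/-! ### Course-of-values recursion -/

/-- An arithmetical condition on `p` and a set `R` that only depends on `R` below `p`. -/
structure IsStep (Φ : A.M → (A.M → Prop) → Prop) : Prop where
  congr : ∀ p R R', (∀ n < p, R n ↔ R' n) → (Φ p R ↔ Φ p R')
  arith : Arith fun e => Φ (e 0) fun n => InCode n (e 1) (e 2)

/-- The predicate defined by course-of-values recursion. -/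
def Rec (Φ : A.M → (A.M → Prop) → Prop) (t : A.M) : Prop :=
  ∃ u v, (∀ p ≤ t, InCode p u v ↔ Φ p fun n => InCode n u v) ∧ InCode t u v

namespace IsStep

variable {Φ : A.M → (A.M → Prop) → Prop} (hΦ : IsStep Φ)
include hΦ

theorem arith_comp {f g k : (ℕ → A.M) → A.M} [hf : TermFn f] [hg : TermFn g] [hk : TermFn k] :
    Arith fun e => Φ (f e) fun n => InCode n (g e) (k e) :=
  Arith.comp₃ (R := fun x u v => Φ x fun n => InCode n u v) hΦ.arith hf hg hk

theorem arith_rec {f : (ℕ → A.M) → A.M} [hf : TermFn f] : Arith fun e => Rec Φ (f e) := by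
  have := @hΦ.arith_comp
  refine Arith.comp₁ (Q := Rec Φ) ?_ hf
  unfold Rec
  infer_instance

theorem code_unique {t u v u' v' : A.M}
    (h : ∀ p ≤ t, InCode p u v ↔ Φ p fun n => InCode n u v)
    (h' : ∀ p ≤ t, InCode p u' v' ↔ Φ p fun n => InCode n u' v') {p : A.M} (hp : p ≤ t) :
    InCode p u v ↔ InCode p u' v' := by
  refine strong_induction (Q := fun p => p ≤ t → (InCode p u v ↔ InCode p u' v'))
    (fun p ih hp => ?_) p hp
  rw [h p hp, h' p hp]
  exact hΦ.congr _ _ _ fun n hn => ih n hn (hn.le.trans hp)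

theorem exists_code (t : A.M) : ∃ u v, ∀ p ≤ t, InCode p u v ↔ Φ p fun n => InCode n u v := by
  have := @hΦ.arith_comp
  refine induction (Q := fun t => ∃ u v, ∀ p ≤ t, InCode p u v ↔ Φ p fun n => InCode n u v)
    ?_ ?_ t
  · obtain ⟨X, hX⟩ := exists_set (A := A) (Q := fun p => Φ p fun n => InCode n 0 0) inferInstance
    obtain ⟨u, v, huv⟩ := ACAModel.exists_code X 0
    refine ⟨u, v, fun p hp => ?_⟩
    rw [huv p hp, hX]
    exact hΦ.congr _ _ _ fun n hn => (not_lt_zero (hn.trans_le hp)).elim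
  · rintro t ⟨u, v, h⟩
    obtain ⟨X, hX⟩ := exists_set (A := A) (Q := fun p => Φ p fun n => InCode n u v) inferInstance
    obtain ⟨u', v', h'⟩ := ACAModel.exists_code X (t + 1)
    refine ⟨u', v', fun p hp => ?_⟩
    rw [h' p hp, hX]
    refine hΦ.congr _ _ _ fun n hn => ?_
    have hnt : n ≤ t := lt_add_one_iff.1 (hn.trans_le hp)
    rw [h n hnt, h' n (hn.le.trans hp), hX]

theorem rec_iff (t : A.M) : Rec Φ t ↔ Φ t (Rec Φ) := by
  obtain ⟨u, v, h⟩ := hΦ.exists_code t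
  have key : ∀ n ≤ t, (Rec Φ n ↔ InCode n u v) := by
    refine fun n hn => ⟨?_, fun hc => ⟨u, v, fun p hp => h p (hp.trans hn), hc⟩⟩
    rintro ⟨u', v', h', hc⟩
    exact (hΦ.code_unique h' (fun p hp => h p (hp.trans hn)) le_rfl).1 hc
  rw [key t le_rfl, h t le_rfl]
  exact hΦ.congr _ _ _ fun n hn => (key n hn.le).symm

end IsStep

/-! ### Meaning of the formulas for pairs and codes -/

section

variable (e : ℕ → A.M) (E : ℕ → A.S)

@[simp] theorem sat_isPair (p x y : Tm) :
    (isPair p x y).Sat A e E ↔ p.val A e = pair (x.val A e) (y.val A e) := by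
  simp [isPair, eq_pair_iff]

@[simp] theorem sat_pairMem (x y : Tm) (X : ℕ) :
    (pairMem x y X).Sat A e E ↔ pair (x.val A e) (y.val A e) ∈ E X := by
  simp [pairMem]

@[simp] theorem sat_isNode (p x y : Tm) :
    (isNode p x y).Sat A e E ↔ p.val A e = node (x.val A e) (y.val A e) := by
  simp [isNode, node]

@[simp] theorem sat_inCode (n u v : Tm) :
    (inCode n u v).Sat A e E ↔ InCode (n.val A e) (u.val A e) (v.val A e) := by
  simp [inCode, InCode]

@[simp] theorem sat_pairInCode (x y u v : Tm) : (pairInCode x y u v).Sat A e E ↔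
    InCode (pair (x.val A e) (y.val A e)) (u.val A e) (v.val A e) := by
  simp [pairInCode]

theorem sat_recursive {Φ : A.M → (A.M → Prop) → Prop} {step : Tm → Tm → Tm → Fml}
    (h : ∀ p u v e E, (step p u v).Sat A e E ↔
      Φ (p.val A e) fun n => InCode n (u.val A e) (v.val A e)) (t : Tm) :
    (recursive step t).Sat A e E ↔ Rec Φ (t.val A e) := by
  simp [recursive, Rec, h]

end

theorem isStep_of_sat {Φ : A.M → (A.M → Prop) → Prop} {step : Tm → Tm → Tm → Fml}
    (h : ∀ p u v e E, (step p u v).Sat A e E ↔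
      Φ (p.val A e) fun n => InCode n (u.val A e) (v.val A e))
    (arith : (step (.var 0) (.var 1) (.var 2)).IsArithmetical)
    (congr : ∀ p R R', (∀ n < p, R n ↔ R' n) → (Φ p R ↔ Φ p R')) : IsStep Φ := by
  obtain ⟨X⟩ := nonempty (A := A)
  have := Arith.sat (A := A) arith fun _ => X
  simp only [h] at this
  exact ⟨congr, this⟩

/-! ### The lexicographic order -/

/-- Recursion step for the lexicographic order, read in a model. -/
def PrecStep (p : A.M) (R : A.M → Prop) : Prop :=
  ∃ x y, p = pair x y ∧ ((x = 0 ∧ y ≠ 0) ∨ ∃ x₀ x' y₀ y', (x = node x₀ x' ∧ y = node y₀ y') ∧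
    (R (pair x₀ y₀) ∨ (x₀ = y₀ ∧ R (pair x' y'))))

theorem sat_precStep (p u v : Tm) (e : ℕ → A.M) (E : ℕ → A.S) : (precStep p u v).Sat A e E ↔
    PrecStep (p.val A e) fun n => InCode n (u.val A e) (v.val A e) := by
  simp [precStep, PrecStep]

theorem pair_lt_pair_node_left (x x' y y' : A.M) : pair x y < pair (node x x') (node y y') :=
  pair_lt_pair (left_lt_node _ _) (left_lt_node _ _)

theorem pair_lt_pair_node_right (x x' y y' : A.M) : pair x' y' < pair (node x x') (node y y') :=
  pair_lt_pair (right_lt_node _ _) (right_lt_node _ _)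

theorem isStep_precStep : IsStep (PrecStep (A := A)) := by
  refine isStep_of_sat sat_precStep ?_ fun p R R' h => ?_
  · simp [precStep, isPair, isNode, pairInCode, inCode, IsArithmetical, Fml.eq, Fml.not]
  · refine exists_congr fun x => exists_congr fun y => and_congr_right ?_
    rintro rfl
    refine or_congr_right (exists_congr fun x₀ => exists_congr fun x' => exists_congr fun y₀ =>
      exists_congr fun y' => and_congr_right ?_)
    rintro ⟨rfl, rfl⟩
    rw [h _ (pair_lt_pair_node_left _ _ _ _), h _ (pair_lt_pair_node_right _ _ _ _)]

/-- `x ≺ y`. -/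
def Prec (x y : A.M) : Prop := Rec PrecStep (pair x y)

/-- `x ≼ y`. -/
def Preceq (x y : A.M) : Prop := Prec x y ∨ x = y

theorem prec_iff {x y : A.M} : Prec x y ↔ (x = 0 ∧ y ≠ 0) ∨ ∃ x₀ x' y₀ y',
    (x = node x₀ x' ∧ y = node y₀ y') ∧ (Prec x₀ y₀ ∨ (x₀ = y₀ ∧ Prec x' y')) := by
  rw [Prec, isStep_precStep.rec_iff]
  constructor
  · rintro ⟨a, b, h, h'⟩
    obtain ⟨rfl, rfl⟩ := pair_inj.1 h
    exact h'
  · exact fun h => ⟨x, y, rfl, h⟩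

theorem prec_node_node {a b c d : A.M} :
    Prec (node a b) (node c d) ↔ Prec a c ∨ (a = c ∧ Prec b d) := by
  rw [prec_iff]
  constructor
  · rintro (⟨h, -⟩ | ⟨x₀, x', y₀, y', ⟨h, h'⟩, k⟩)
    · exact (node_ne_zero _ _ h).elim
    · obtain ⟨rfl, rfl⟩ := node_inj.1 h
      obtain ⟨rfl, rfl⟩ := node_inj.1 h'
      exact k
  · exact fun h => .inr ⟨a, b, c, d, ⟨rfl, rfl⟩, h⟩

theorem zero_prec {x : A.M} (hx : x ≠ 0) : Prec 0 x := prec_iff.2 (.inl ⟨rfl, hx⟩)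

theorem not_prec_zero (x : A.M) : ¬ Prec x 0 := by
  rw [prec_iff]
  rintro (⟨-, h⟩ | ⟨_, _, _, _, ⟨-, h⟩, -⟩)
  · exact h rfl
  · exact node_ne_zero _ _ h.symm

theorem zero_preceq (x : A.M) : Preceq 0 x := by
  by_cases hx : x = 0
  · exact .inr hx.symm
  · exact .inl (zero_prec hx)

instance {f g : (ℕ → A.M) → A.M} [hf : TermFn f] [hg : TermFn g] :
    Arith fun e => Prec (f e) (g e) := by
  refine Arith.comp₂ (R := Prec) ?_ hf hg
  have := @isStep_precStep.arith_rec (A := A)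
  have key : ∀ x y : A.M, Prec x y ↔ ∃ p, p = pair x y ∧ Rec PrecStep p := by simp [Prec]
  simp only [key]
  infer_instance

instance {f g : (ℕ → A.M) → A.M} [TermFn f] [TermFn g] : Arith fun e => Preceq (f e) (g e) := by
  unfold Preceq; infer_instance

theorem prec_trans {x y z : A.M} (h : Prec x y) (h' : Prec y z) : Prec x z := by
  refine node_induction (Q := fun x => ∀ y z, Prec x y → Prec y z → Prec x z) ?_ ?_ x y z h h'
  · intro y z _ h'
    refine zero_prec ?_
    rintro rfl
    exact not_prec_zero _ h'
  · intro a b iha ihb y z h h'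
    rcases eq_zero_or_eq_node y with rfl | ⟨c, d, rfl⟩
    · exact (not_prec_zero _ h).elim
    rcases eq_zero_or_eq_node z with rfl | ⟨c', d', rfl⟩
    · exact (not_prec_zero _ h').elim
    rw [prec_node_node] at *
    rcases h with h | ⟨rfl, h⟩
    · rcases h' with h' | ⟨rfl, -⟩
      · exact .inl (iha _ _ h h')
      · exact .inl h
    · rcases h' with h' | ⟨rfl, h'⟩
      · exact .inl h'
      · exact .inr ⟨rfl, ihb _ _ h h'⟩

theorem prec_of_preceq_of_prec {x y z : A.M} (h : Preceq x y) (h' : Prec y z) : Prec x z := by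
  rcases h with h | rfl
  exacts [prec_trans h h', h']

theorem head_prec (a b : A.M) : Prec a (node a b) := by
  refine node_induction (Q := fun a => ∀ b, ∀ n, n = node a b → Prec a n) ?_ ?_ a b _ rfl
  · rintro b _ rfl
    exact zero_prec (node_ne_zero _ _)
  · rintro a a' ih - b _ rfl
    exact prec_node_node.2 (.inl (ih a' _ rfl))

/-! ### The set `ε₀` -/

/-- Recursion step for `ε₀`, read in a model. -/
def Eps0Step (p : A.M) (R : A.M → Prop) : Prop :=
  p = 0 ∨ ∃ x y, p = node x y ∧ (R x ∧ R y) ∧ (y = 0 ∨ ∃ z w, y = node z w ∧ Preceq z x)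

section

variable (e : ℕ → A.M) (E : ℕ → A.S)

@[simp] theorem sat_prec (x y : Tm) :
    (prec x y).Sat A e E ↔ Prec (x.val A e) (y.val A e) := by
  simp [prec, sat_recursive _ _ sat_precStep, Prec]

@[simp] theorem sat_preceq (x y : Tm) :
    (preceq x y).Sat A e E ↔ Preceq (x.val A e) (y.val A e) := by
  simp [preceq, Preceq]

end

theorem sat_eps0Step (p u v : Tm) (e : ℕ → A.M) (E : ℕ → A.S) : (eps0Step p u v).Sat A e E ↔
    Eps0Step (p.val A e) fun n => InCode n (u.val A e) (v.val A e) := by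
  simp [eps0Step, Eps0Step]

theorem isStep_eps0Step : IsStep (Eps0Step (A := A)) := by
  refine isStep_of_sat sat_eps0Step ?_ fun p R R' h => ?_
  · simp [eps0Step, preceq, prec, recursive, precStep, isPair, isNode, pairInCode, inCode,
      IsArithmetical, Fml.eq, Fml.le, Fml.not, imp, iff]
  · refine or_congr_right (exists_congr fun x => exists_congr fun y => and_congr_right ?_)
    rintro rfl
    rw [h _ (left_lt_node _ _), h _ (right_lt_node _ _)]

/-- `x ∈ ε₀`. -/
def Eps0 (x : A.M) : Prop := Rec Eps0Step x

instance {f : (ℕ → A.M) → A.M} [TermFn f] : Arith fun e => Eps0 (f e) :=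
  isStep_eps0Step.arith_rec

theorem eps0_zero : Eps0 (0 : A.M) := (isStep_eps0Step.rec_iff _).2 (.inl rfl)

theorem eps0_node {x y : A.M} :
    Eps0 (node x y) ↔ (Eps0 x ∧ Eps0 y) ∧ (y = 0 ∨ ∃ z w, y = node z w ∧ Preceq z x) := by
  rw [Eps0, isStep_eps0Step.rec_iff]
  constructor
  · rintro (h | ⟨a, b, h, h'⟩)
    · exact (node_ne_zero _ _ h).elim
    · obtain ⟨rfl, rfl⟩ := node_inj.1 h
      exact h'
  · exact fun h => .inr ⟨x, y, rfl, h⟩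

theorem tail_prec {a b : A.M} (h : Eps0 (node a b)) : Prec b (node a b) := by
  refine node_induction (Q := fun b => ∀ a, ∀ n, n = node a b → Eps0 n → Prec b n) ?_ ?_ b a _
    rfl h
  · rintro a _ rfl -
    exact zero_prec (node_ne_zero _ _)
  · rintro c b - ih a _ rfl h
    obtain ⟨⟨-, hb⟩, h' | ⟨z, w, h', hz⟩⟩ := eps0_node.1 h
    · exact (node_ne_zero _ _ h').elim
    obtain ⟨rfl, rfl⟩ := node_inj.1 h'
    rcases hz with hz | rfl
    · exact prec_node_node.2 (.inl hz)
    · exact prec_node_node.2 (.inr ⟨rfl, ih _ _ rfl hb⟩)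

/-! ### Binary trees -/

/-- Recursion step for the set of binary trees, read in a model. -/
def TreeStep (p : A.M) (R : A.M → Prop) : Prop := p = 0 ∨ ∃ s t, p = node s t ∧ R s ∧ R t

theorem sat_treeStep (p u v : Tm) (e : ℕ → A.M) (E : ℕ → A.S) : (treeStep p u v).Sat A e E ↔
    TreeStep (p.val A e) fun n => InCode n (u.val A e) (v.val A e) := by
  simp [treeStep, TreeStep]

theorem isStep_treeStep : IsStep (TreeStep (A := A)) := by
  refine isStep_of_sat sat_treeStep ?_ fun p R R' h => ?_
  · simp [treeStep, isPair, isNode, inCode, IsArithmetical, Fml.eq]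
  · refine or_congr_right (exists_congr fun x => exists_congr fun y => and_congr_right ?_)
    rintro rfl
    rw [h _ (left_lt_node _ _), h _ (right_lt_node _ _)]

theorem rec_treeStep (x : A.M) : Rec TreeStep x := by
  have := @isStep_treeStep.arith_rec (A := A)
  refine node_induction (Q := Rec TreeStep) ?_ (fun s t hs ht => ?_) x
  · exact (isStep_treeStep.rec_iff _).2 (.inl rfl)
  · exact (isStep_treeStep.rec_iff _).2 (.inr ⟨s, t, rfl, hs, ht⟩)

/-- Recursion step for the order on binary trees, read in a model. -/
def TreeLeStep (p : A.M) (R : A.M → Prop) : Prop :=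
  ∃ s t, p = pair s t ∧ (s = 0 ∨ ∃ s₀ s₁ t₀ t₁, (s = node s₀ s₁ ∧ t = node t₀ t₁) ∧
    ((R (pair s₀ t₀) ∧ R (pair s₁ t₁)) ∨ R (pair s t₀) ∨ R (pair s t₁)))

theorem sat_treeLeStep (p u v : Tm) (e : ℕ → A.M) (E : ℕ → A.S) : (treeLeStep p u v).Sat A e E ↔
    TreeLeStep (p.val A e) fun n => InCode n (u.val A e) (v.val A e) := by
  simp [treeLeStep, TreeLeStep]

theorem isStep_treeLeStep : IsStep (TreeLeStep (A := A)) := by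
  refine isStep_of_sat sat_treeLeStep ?_ fun p R R' h => ?_
  · simp [treeLeStep, isPair, isNode, pairInCode, inCode, IsArithmetical, Fml.eq]
  · refine exists_congr fun x => exists_congr fun y => and_congr_right ?_
    rintro rfl
    refine or_congr_right (exists_congr fun x₀ => exists_congr fun x' => exists_congr fun y₀ =>
      exists_congr fun y' => and_congr_right ?_)
    rintro ⟨rfl, rfl⟩
    rw [h _ (pair_lt_pair_node_left _ _ _ _), h _ (pair_lt_pair_node_right _ _ _ _),
      h _ (pair_lt_pair_right _ (left_lt_node _ _)), h _ (pair_lt_pair_right _ (right_lt_node _ _))]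

/-- `s ≤ t` for binary trees. -/
def TreeLe (s t : A.M) : Prop := Rec TreeLeStep (pair s t)

theorem treeLe_iff {s t : A.M} : TreeLe s t ↔ s = 0 ∨ ∃ s₀ s₁ t₀ t₁,
    (s = node s₀ s₁ ∧ t = node t₀ t₁) ∧
      ((TreeLe s₀ t₀ ∧ TreeLe s₁ t₁) ∨ TreeLe s t₀ ∨ TreeLe s t₁) := by
  rw [TreeLe, isStep_treeLeStep.rec_iff]
  constructor
  · rintro ⟨a, b, h, h'⟩
    obtain ⟨rfl, rfl⟩ := pair_inj.1 h
    exact h'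
  · exact fun h => ⟨s, t, rfl, h⟩

instance {f g : (ℕ → A.M) → A.M} [hf : TermFn f] [hg : TermFn g] :
    Arith fun e => TreeLe (f e) (g e) := by
  refine Arith.comp₂ (R := TreeLe) ?_ hf hg
  have := @isStep_treeLeStep.arith_rec (A := A)
  have key : ∀ x y : A.M, TreeLe x y ↔ ∃ p, p = pair x y ∧ Rec TreeLeStep p := by simp [TreeLe]
  simp only [key]
  infer_instance

/-- The order on `ε₀` extends the order on binary trees. -/
theorem preceq_of_treeLe {a b : A.M} (ha : Eps0 a) (hb : Eps0 b) (h : TreeLe a b) :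
    Preceq a b := by
  refine node_induction (Q := fun b => ∀ a, Eps0 a → Eps0 b → TreeLe a b → Preceq a b)
    ?_ ?_ b a ha hb h
  · intro a _ _ h
    rcases treeLe_iff.1 h with rfl | ⟨_, _, _, _, ⟨-, h⟩, -⟩
    · exact .inr rfl
    · exact (node_ne_zero _ _ h.symm).elim
  · intro b₀ b₁ ih₀ ih₁ a ha hb h
    obtain ⟨⟨hb₀, hb₁⟩, -⟩ := eps0_node.1 hb
    rcases treeLe_iff.1 h with rfl | ⟨a₀, a₁, _, _, ⟨rfl, hn⟩, h' | h' | h'⟩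
    · exact zero_preceq _
    all_goals obtain ⟨rfl, rfl⟩ := node_inj.1 hn
    · obtain ⟨⟨ha₀, ha₁⟩, -⟩ := eps0_node.1 ha
      rcases ih₀ _ ha₀ hb₀ h'.1 with h₀ | rfl
      · exact .inl (prec_node_node.2 (.inl h₀))
      rcases ih₁ _ ha₁ hb₁ h'.2 with h₁ | rfl
      · exact .inl (prec_node_node.2 (.inr ⟨rfl, h₁⟩))
      · exact .inr rfl
    · exact .inl (prec_of_preceq_of_prec (ih₀ _ ha hb₀ h') (head_prec _ _))
    · exact .inl (prec_of_preceq_of_prec (ih₁ _ ha hb₁ h') (tail_prec hb))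

/-! ### The quasi-embedding -/

section

variable (e : ℕ → A.M) (E : ℕ → A.S)

@[simp] theorem sat_inEps0 (x : Tm) : (inEps0 x).Sat A e E ↔ Eps0 (x.val A e) := by
  simp [inEps0, sat_recursive _ _ sat_eps0Step, Eps0]

@[simp] theorem sat_inTrees (x : Tm) : (inTrees x).Sat A e E := by
  simp [inTrees, sat_recursive _ _ sat_treeStep, rec_treeStep]

@[simp] theorem sat_treeLe (x y : Tm) :
    (treeLe x y).Sat A e E ↔ TreeLe (x.val A e) (y.val A e) := by
  simp [treeLe, sat_recursive _ _ sat_treeLeStep, TreeLe]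

/-- Terms in `ε₀` and the associated binary trees have the same codes, so that the quasi-embedding
is represented by a diagonal set. -/
theorem sat_existsQuasiEmbedding : existsQuasiEmbedding.Sat A e E := by
  obtain ⟨F, hF⟩ := exists_set (A := A) (Q := fun p => ∃ a, p = pair a a ∧ Eps0 a) inferInstance
  have mem_iff : ∀ a s, pair a s ∈ F ↔ a = s ∧ Eps0 a := by
    intro a s
    rw [hF]
    constructor
    · rintro ⟨b, h, hb⟩
      obtain ⟨rfl, rfl⟩ := pair_inj.1 h
      exact ⟨rfl, hb⟩
    · rintro ⟨rfl, h⟩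
      exact ⟨a, rfl, h⟩
  refine ⟨F, ?_, ?_, ?_⟩
  · simp only [isFunction, sat_and, all₁, all₃, ex₁, ex₂, sat_all, sat_ex, sat_imp, sat_mem,
      sat_isPair, sat_inEps0, sat_inTrees, sat_pairMem, sat_eq, Tm.val_var, Tm.val_lift_one,
      Tm.val_lift_two, cons_zero, cons_one, cons_two, mem_iff, and_true]
    refine ⟨fun p hp => ?_, fun a ha => ⟨a, rfl, ha⟩, ?_⟩
    · obtain ⟨a, rfl, ha⟩ := (hF p).1 hp
      exact ⟨a, a, rfl, ha⟩
    · rintro a s t ⟨⟨rfl, -⟩, rfl, -⟩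
      rfl
  · simp only [satisfiesRecursion, sat_and, all₃, ex₁, ex₂, sat_all, sat_ex, sat_imp, sat_isNode,
      sat_inEps0, sat_pairMem, Tm.val_var, Tm.val_zero, Tm.val_lift_one, Tm.val_lift_two,
      Tm.val_lift_three, cons_zero, cons_one, cons_two, mem_iff]
    refine ⟨⟨trivial, eps0_zero⟩, ?_⟩
    rintro a x y ⟨ha, rfl⟩
    obtain ⟨⟨hx, hy⟩, -⟩ := eps0_node.1 ha
    exact ⟨x, y, ⟨⟨rfl, hx⟩, rfl, hy⟩, node x y, rfl, rfl, ha⟩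
  · simp only [reflectsOrder, sat_and, all₂, sat_all, sat_imp, sat_inEps0, sat_pairMem,
      sat_treeLe, sat_preceq, Tm.val_var, Tm.val_lift_two, cons_zero, cons_one, mem_iff]
    rintro a b ⟨ha, hb⟩ s t ⟨⟨⟨rfl, -⟩, rfl, -⟩, h⟩
    exact preceq_of_treeLe ha hb h

end

end ACAModel

end SecondOrderArithmetic

/-- `ACA₀` proves that there is a function `f : ε₀ → B` with `f(⟨⟩) = ∘` and
`f(⟨α₀, …, αₙ₋₁⟩) = ∘(f(α₀), f(⟨α₁, …, αₙ₋₁⟩))` for `n > 0` that reflects the order. -/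
theorem proposition6p4 :
    SecondOrderArithmetic.Proves SecondOrderArithmetic.ACA₀
      SecondOrderArithmetic.existsQuasiEmbedding :=
  SecondOrderArithmetic.proves_ACA₀_of_forall_models fun A heq hA e E =>
    have : SecondOrderArithmetic.ACAModel A := ⟨heq, hA, ⟨E 0⟩⟩
    SecondOrderArithmetic.ACAModel.sat_existsQuasiEmbedding e E
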